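/- Let $\Bbbk$ be a field. For a finite simple graph $G$ with vertex set $V$ let $S=\Bbbk[x_v,y_v : v\in V]$ with the standard grading and let $J_G=\langle x_iy_j-y_ix_j : \{i,j\}\in E(G)\rangle\subset S$ be its binomial edge ideal. Let $$\operatorname{reg}(S/J_G)=\max\{j-i : \beta_{i,j}(S/J_G)\neq 0\},\qquad \beta_{i,j}(S/J_G)=\dim_{\Bbbk}\operatorname{Tor}^S_i(S/J_G,\Bbbk)_j,$$ be the Castelnuovo--Mumford regularity. A cograph is a graph without an induced path on four vertices (an induced path of length $3$). **Theorem.** Let $G$ be a cograph on $n=3k-a$ vertices, with $k\in\mathbb N$ and $a\in\{0,1,2\}$. Then $$\operatorname{reg}(S/J_G)\le 2k-a,$$ and in particular $\operatorname{reg}(S/J_G)\le \lfloor 2n/3\rfloor$. If moreover $G$ is connected, $k>1$ and $a\in\{0,1\}$, then $$\operatorname{reg}(S/J_G)\le 2k-a-1.$$ -/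

import Mathlib

open MvPolynomial

namespace SimpleGraph

/-- A graph is a cograph (complement reducible graph) if it has no induced path of length 3,
i.e. no induced subgraph isomorphic to the path on 4 vertices. -/
def IsCograph {V : Type*} (G : SimpleGraph V) : Prop :=
  ¬ (pathGraph 4).IsIndContained G

end SimpleGraph

section Koszul

/-! ### Graded Betti numbers and Castelnuovo-Mumford regularity

Let `S = 𝕜[x_v : v ∈ σ]` with the standard grading, and let `M` be a graded `S`-module with
homogeneous components `ℳ e`. The graded vector space `Tor_i^S(M, 𝕜)` is the homology of `M ⊗_S P`,
for `P` a graded free resolution of `𝕜`. We take for `P` the standard one, the Koszul complex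
`S ⊗ ⋀ 𝕜^σ` on the variables, where the basis vectors `e_T` (`T ⊆ σ`) have homological
degree `|T|` and internal degree `|T|`. -/

/-- The Koszul differential on `M ⊗ ⋀ 𝕜^σ`. An element `∑_T c_T ⊗ e_T` is stored as the function
`T ↦ c_T`. The differential is
`m ⊗ e_T ↦ ∑_{v ∈ T} (-1) ^ #{u ∈ T | u < v} x_v m ⊗ e_{T \ {v}}`. -/
noncomputable def koszulDifferential (σ 𝕜 M : Type*) [Fintype σ] [LinearOrder σ] [Field 𝕜] [AddCommGroup M]
    [Module 𝕜 M] [Module (MvPolynomial σ 𝕜) M] [IsScalarTower 𝕜 (MvPolynomial σ 𝕜) M] :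
    (Finset σ → M) →ₗ[𝕜] (Finset σ → M) where
  toFun c := fun U => ∑ v ∈ Uᶜ,
    (-1 : ℤ) ^ (U.filter (· < v)).card • ((X v : MvPolynomial σ 𝕜) • c (insert v U))
  map_add' c c' := by
    funext U
    simp [smul_add, Finset.sum_add_distrib]
  map_smul' r c := by
    funext U
    simp only [Pi.smul_apply, RingHom.id_apply, Finset.smul_sum]
    refine Finset.sum_congr rfl fun v _ => ?_
    rw [smul_algebra_smul_comm r (X v : MvPolynomial σ 𝕜), smul_comm _ r]

/-- The Koszul differential squares to zero. -/
theorem koszulDifferential_koszulDifferential {σ 𝕜 M : Type*} [Fintype σ] [LinearOrder σ]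
    [Field 𝕜] [AddCommGroup M] [Module 𝕜 M] [Module (MvPolynomial σ 𝕜) M]
    [IsScalarTower 𝕜 (MvPolynomial σ 𝕜) M] (c : Finset σ → M) :
    koszulDifferential σ 𝕜 M (koszulDifferential σ 𝕜 M c) = 0 := by
  have key : ∀ (U : Finset σ) (a b : σ), a ∉ U → a < b →
      ((insert a U).filter (· < b)).card = (U.filter (· < b)).card + 1 ∧
      ((insert b U).filter (· < a)).card = (U.filter (· < a)).card := by
    intro U a b ha hab
    constructor
    · rw [Finset.filter_insert, if_pos hab, Finset.card_insert_of_notMem]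
      simp [ha]
    · rw [Finset.filter_insert, if_neg (not_lt.mpr hab.le)]
  have hcancel : ∀ (U : Finset σ) (a b : σ), a ∉ U → a < b →
      (-1 : ℤ) ^ (U.filter (· < a)).card * (-1) ^ ((insert a U).filter (· < b)).card +
      (-1) ^ (U.filter (· < b)).card * (-1) ^ ((insert b U).filter (· < a)).card = 0 := by
    intro U a b ha hab
    rw [(key U a b ha hab).1, (key U a b ha hab).2]
    ring
  funext U
  simp only [koszulDifferential, LinearMap.coe_mk, AddHom.coe_mk, Finset.smul_sum, Pi.zero_apply]
  rw [Finset.sum_sigma']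
  refine Finset.sum_involution (fun p _ => ⟨p.2, p.1⟩) ?_ ?_ ?_ ?_
  · rintro ⟨v, w⟩ h
    simp only [Finset.mem_sigma, Finset.mem_compl, Finset.mem_insert, not_or] at h
    obtain ⟨hv, hwv, hw⟩ := h
    simp only [smul_comm (X w : MvPolynomial σ 𝕜) ((_ : ℤ)),
      smul_comm (X v : MvPolynomial σ 𝕜) ((_ : ℤ)), smul_smul ((_ : ℤ)) ((_ : ℤ))]
    rw [Finset.insert_comm w v, smul_comm (X w : MvPolynomial σ 𝕜) (X v : MvPolynomial σ 𝕜),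
      ← add_smul]
    convert zero_smul ℤ _ using 2
    rcases lt_or_gt_of_ne hwv with h | h
    · rw [add_comm]
      exact hcancel U w v hw h
    · exact hcancel U v w hv h
  · rintro ⟨v, w⟩ h _ heq
    simp only [Finset.mem_sigma, Finset.mem_compl, Finset.mem_insert, not_or] at h
    simp only [Sigma.mk.injEq] at heq
    exact h.2.1 heq.1
  · rintro ⟨v, w⟩ h
    simp only [Finset.mem_sigma, Finset.mem_compl, Finset.mem_insert, not_or] at h ⊢
    exact ⟨h.2.2, fun e => h.2.1 e.symm, h.1⟩
  · simp

/-- The part of homological degree `i` and internal degree `j` of `M ⊗ ⋀ 𝕜^σ`: the sums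
`∑_{|T| = i} c_T ⊗ e_T` with all `c_T` in `ℳ (j - i)`. -/
def koszulChains (σ : Type*) {𝕜 M : Type*} [Field 𝕜] [AddCommGroup M] [Module 𝕜 M]
    (ℳ : ℤ → Submodule 𝕜 M) (i : ℕ) (j : ℤ) : Submodule 𝕜 (Finset σ → M) where
  carrier := {c | ∀ T : Finset σ, c T ∈ ℳ (j - i) ∧ (T.card ≠ i → c T = 0)}
  zero_mem' T := by simp
  add_mem' {c c'} hc hc' T :=
    ⟨add_mem (hc T).1 (hc' T).1, fun h => by simp [(hc T).2 h, (hc' T).2 h]⟩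
  smul_mem' r c hc T :=
    ⟨Submodule.smul_mem _ r (hc T).1, fun h => by simp [(hc T).2 h]⟩

/-- Cycles of homological degree `i` and internal degree `j`. -/
noncomputable def koszulCycles (σ : Type*) {𝕜 M : Type*} [Fintype σ] [LinearOrder σ] [Field 𝕜]
    [AddCommGroup M] [Module 𝕜 M] [Module (MvPolynomial σ 𝕜) M]
    [IsScalarTower 𝕜 (MvPolynomial σ 𝕜) M]
    (ℳ : ℤ → Submodule 𝕜 M) (i : ℕ) (j : ℤ) : Submodule 𝕜 (Finset σ → M) :=
  koszulChains σ ℳ i j ⊓ LinearMap.ker (koszulDifferential σ 𝕜 M)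

/-- Boundaries of homological degree `i` and internal degree `j`. -/
noncomputable def koszulBoundaries (σ : Type*) {𝕜 M : Type*} [Fintype σ] [LinearOrder σ] [Field 𝕜]
    [AddCommGroup M] [Module 𝕜 M] [Module (MvPolynomial σ 𝕜) M]
    [IsScalarTower 𝕜 (MvPolynomial σ 𝕜) M]
    (ℳ : ℤ → Submodule 𝕜 M) (i : ℕ) (j : ℤ) : Submodule 𝕜 (Finset σ → M) :=
  (koszulChains σ ℳ (i + 1) j).map (koszulDifferential σ 𝕜 M)

/-- `Tor_i^S(M, 𝕜)_j` for `S = 𝕜[x_v : v ∈ σ]`. -/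
abbrev gradedTor (σ : Type*) {𝕜 M : Type*} [Fintype σ] [LinearOrder σ] [Field 𝕜]
    [AddCommGroup M] [Module 𝕜 M] [Module (MvPolynomial σ 𝕜) M]
    [IsScalarTower 𝕜 (MvPolynomial σ 𝕜) M]
    (ℳ : ℤ → Submodule 𝕜 M) (i : ℕ) (j : ℤ) : Type _ :=
  koszulCycles σ ℳ i j ⧸ (koszulBoundaries σ ℳ i j).submoduleOf (koszulCycles σ ℳ i j)

/-- The graded Betti number `β_{i,j}(M) = dim_𝕜 Tor_i^S(M, 𝕜)_j`. -/
noncomputable def gradedBetti (σ : Type*) {𝕜 M : Type*} [Fintype σ] [LinearOrder σ] [Field 𝕜]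
    [AddCommGroup M] [Module 𝕜 M] [Module (MvPolynomial σ 𝕜) M]
    [IsScalarTower 𝕜 (MvPolynomial σ 𝕜) M]
    (ℳ : ℤ → Submodule 𝕜 M) (i : ℕ) (j : ℤ) : ℕ :=
  Module.finrank 𝕜 (gradedTor σ ℳ i j)

/-- The Castelnuovo-Mumford regularity `reg M = max {j - i : β_{i,j}(M) ≠ 0}`, as a supremum in
`ℤ ∪ {-∞, ∞}`. -/
noncomputable def cmRegularity (σ : Type*) {𝕜 M : Type*} [Fintype σ] [LinearOrder σ] [Field 𝕜]
    [AddCommGroup M] [Module 𝕜 M] [Module (MvPolynomial σ 𝕜) M]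
    [IsScalarTower 𝕜 (MvPolynomial σ 𝕜) M]
    (ℳ : ℤ → Submodule 𝕜 M) : WithBot (WithTop ℤ) :=
  ⨆ (i : ℕ) (j : ℤ) (_ : gradedBetti σ ℳ i j ≠ 0), (((j - i : ℤ) : WithTop ℤ) : WithBot (WithTop ℤ))

end Koszul

/-- The homogeneous component of degree `e` of `S ⧸ I` (`I` a homogeneous ideal of
`S = 𝕜[x_v : v ∈ σ]`): the classes of the homogeneous polynomials of degree `e`; it is zero
for `e < 0`. -/
noncomputable def quotientGrading {σ 𝕜 : Type*} [Field 𝕜] (I : Ideal (MvPolynomial σ 𝕜)) :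
    ℤ → Submodule 𝕜 (MvPolynomial σ 𝕜 ⧸ I)
  | Int.ofNat d => (homogeneousSubmodule σ 𝕜 d).map (Ideal.Quotient.mkₐ 𝕜 I).toLinearMap
  | Int.negSucc _ => ⊥

/-- The variables `x_i`, `y_i` (`i ∈ V`). The order on them serves only to fix the signs in the
Koszul complex. -/
abbrev BEIVar (V : Type*) : Type _ := V ⊕ₗ V

/-- The binomial edge ideal `J_G = ⟨x_i y_j - y_i x_j : {i, j} ∈ E(G)⟩`. -/
noncomputable def binomialEdgeIdeal (𝕜 : Type*) [Field 𝕜] {V : Type*} (G : SimpleGraph V) :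
    Ideal (MvPolynomial (BEIVar V) 𝕜) :=
  Ideal.span {p | ∃ i j : V, G.Adj i j ∧
    p = X (Sum.inlₗ i) * X (Sum.inrₗ j) - X (Sum.inrₗ i) * X (Sum.inlₗ j)}

/-- `reg (S / J_G)` for `S = 𝕜[x_i, y_i : i ∈ V]`. -/
noncomputable def regBEI (𝕜 : Type*) [Field 𝕜] {V : Type*} [Fintype V] [LinearOrder V]
    (G : SimpleGraph V) : WithBot (WithTop ℤ) :=
  cmRegularity (BEIVar V) (quotientGrading (binomialEdgeIdeal 𝕜 G))

/-!
The regularity of `S ⧸ I` is at most `r` if every Koszul cycle modulo `I` of internal degree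
exceeding its homological degree by more than `r` is a boundary modulo `I`; this is `RegLE I r`. It
is stated with chains over the polynomial ring `S` and congruences modulo `I`, so that the long exact
sequences of Tor become short computations with chains. Four of them are used: for an intersection
of ideals (`RegLE.inf`), for multiplication by a variable (`RegLE.of_colon`), and two for a variable
that is a nonzerodivisor modulo the ideal (`RegLE.sup_span_X`, `RegLE.of_sup_span_X`).

All bounds are proved for `J + I`, where `J` belongs to a graph on a vertex set `W` and `I` is an
arbitrary homogeneous ideal in the variables of the other vertices. The bounds have the form
`reg S/(J + I) ≤ reg S/I + f(W)`. In this form they can be iterated: for a disjoint union of graphs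
on `W₁` and `W₂` one applies the bound for `W₁` to the ideal `J_{W₂} + I`, which replaces the Künneth
formula. Passing between `S/I` and its quotient by variables not involved in `I` does not change the
regularity, as these variables form a regular sequence.

For a complete graph `f = 1` (`FreeOf.regLE_complete`). A variable `x_w` is a nonzerodivisor modulo
the `2`-minors of a generic `2 × n` matrix, since these generate the kernel of the parametrization
`x_i ↦ s z_i`, `y_i ↦ z_i` (`ker_segreMap`). Modulo `x_w`, multiplication by `y_w` has an
annihilator generated, modulo `I`, by the variables `x_i`, and its cokernel belongs to the complete graph on
`W \ {w}`.

For a join of graphs on `W₁` and `W₂`, the Plücker relations show that a variable of `W₂` multiplies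
every minor of `W₁` into the ideal of the bipartite edges. Hence `J + I` is the intersection of the
ideal obtained by completing `W₁` and the ideal obtained by killing the variables of `W₂`
(`pairIdeal_join_eq_inf`), and their sum belongs to a complete graph. Completing both sides gives
`f(W) ≤ max (f(W₁), f(W₂), 2)` (`FreeOf.regLE_join`).

A cograph with at least two vertices is a disjoint union or a join
(`SimpleGraph.NoInducedPath.exists_separated`), so `f(W) ≤ ⌊2|W|/3⌋` by induction. A connected
cograph is a join of two graphs with at most `n - 1` vertices, which gives the sharper bound.
-/

/-! ### Koszul chains with polynomial coefficients -/

section Chains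

variable {σ 𝕜 : Type*} [Field 𝕜]

/-- Chains `∑_{|T| = i} c_T ⊗ e_T` of homological degree `i` whose coefficients `c_T` are homogeneous
polynomials of degree `d`; their internal degree is `i + d`. -/
def IsKoszulChain (i d : ℕ) (c : Finset σ → MvPolynomial σ 𝕜) : Prop :=
  ∀ T, (c T).IsHomogeneous d ∧ (T.card ≠ i → c T = 0)

lemma IsKoszulChain.add {i d : ℕ} {c c' : Finset σ → MvPolynomial σ 𝕜}
    (hc : IsKoszulChain i d c) (hc' : IsKoszulChain i d c') : IsKoszulChain i d (c + c') :=
  fun T => ⟨(hc T).1.add (hc' T).1, fun h => by simp [(hc T).2 h, (hc' T).2 h]⟩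

lemma IsKoszulChain.sub {i d : ℕ} {c c' : Finset σ → MvPolynomial σ 𝕜}
    (hc : IsKoszulChain i d c) (hc' : IsKoszulChain i d c') : IsKoszulChain i d (c - c') :=
  fun T => ⟨(hc T).1.sub (hc' T).1, fun h => by simp [(hc T).2 h, (hc' T).2 h]⟩

lemma IsKoszulChain.zero (i d : ℕ) : IsKoszulChain i d (0 : Finset σ → MvPolynomial σ 𝕜) :=
  fun _ => ⟨isHomogeneous_zero _ _ _, fun _ => rfl⟩

lemma IsKoszulChain.X_mul {i d : ℕ} {c : Finset σ → MvPolynomial σ 𝕜} (hc : IsKoszulChain i d c)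
    (v : σ) : IsKoszulChain i (d + 1) (fun T => X v * c T) :=
  fun T => ⟨by rw [add_comm]; exact (isHomogeneous_X 𝕜 v).mul (hc T).1,
    fun h => by simp [(hc T).2 h]⟩

variable [LinearOrder σ]

/-- The sign of moving `e_v` past the other factors does not depend on whether `v` is present. -/
lemma filter_lt_erase (v : σ) (U : Finset σ) : (U.erase v).filter (· < v) = U.filter (· < v) := by
  ext u
  simp only [Finset.mem_filter, Finset.mem_erase]
  exact ⟨fun h => ⟨h.1.2, h.2⟩, fun h => ⟨⟨h.2.ne, h.1⟩, h.2⟩⟩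

/-- Left exterior multiplication by the basis vector `e_v`. -/
noncomputable def koszulHomotopy (v : σ) (c : Finset σ → MvPolynomial σ 𝕜) :
    Finset σ → MvPolynomial σ 𝕜 :=
  fun T => if v ∈ T then (-1 : ℤ) ^ (T.filter (· < v)).card • c (T.erase v) else 0

lemma IsKoszulChain.koszulHomotopy {i d : ℕ} {c : Finset σ → MvPolynomial σ 𝕜}
    (hc : IsKoszulChain i d c) (v : σ) : IsKoszulChain (i + 1) d (koszulHomotopy v c) := by
  intro T
  rw [_root_.koszulHomotopy]
  split_ifs with hv
  · constructor
    · have h := (hc (T.erase v)).1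
      rw [← mem_homogeneousSubmodule] at h ⊢
      exact zsmul_mem h _
    · intro hT
      rw [(hc _).2, smul_zero]
      have := Finset.card_pos.mpr ⟨v, hv⟩
      rw [Finset.card_erase_of_mem hv]
      omega
  · exact ⟨isHomogeneous_zero _ _ _, fun _ => rfl⟩

lemma koszulHomotopy_mem {I : Ideal (MvPolynomial σ 𝕜)} {c : Finset σ → MvPolynomial σ 𝕜}
    (hc : ∀ T, c T ∈ I) (v : σ) (U : Finset σ) : koszulHomotopy v c U ∈ I := by
  rw [koszulHomotopy]
  split_ifs
  · exact zsmul_mem (hc _) _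
  · exact I.zero_mem

variable [Fintype σ]

/-- The Koszul differential of the polynomial ring, regarded as a module over itself. -/
noncomputable def polyKoszul (c : Finset σ → MvPolynomial σ 𝕜) : Finset σ → MvPolynomial σ 𝕜 :=
  koszulDifferential σ 𝕜 (MvPolynomial σ 𝕜) c

lemma polyKoszul_add (b c : Finset σ → MvPolynomial σ 𝕜) :
    polyKoszul (b + c) = polyKoszul b + polyKoszul c :=
  map_add _ _ _

lemma polyKoszul_sub (b c : Finset σ → MvPolynomial σ 𝕜) :
    polyKoszul (b - c) = polyKoszul b - polyKoszul c :=
  map_sub _ _ _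

lemma koszulDifferential_apply {M : Type*} [AddCommGroup M] [Module 𝕜 M]
    [Module (MvPolynomial σ 𝕜) M] [IsScalarTower 𝕜 (MvPolynomial σ 𝕜) M]
    (c : Finset σ → M) (U : Finset σ) :
    koszulDifferential σ 𝕜 M c U = ∑ v ∈ Uᶜ,
      (-1 : ℤ) ^ (U.filter (· < v)).card • ((X v : MvPolynomial σ 𝕜) • c (insert v U)) := rfl

lemma polyKoszul_mul (y : MvPolynomial σ 𝕜) (c : Finset σ → MvPolynomial σ 𝕜) :
    polyKoszul (fun T => y * c T) = fun T => y * polyKoszul c T := by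
  funext U
  simp only [polyKoszul, koszulDifferential_apply, smul_eq_mul, Finset.mul_sum]
  refine Finset.sum_congr rfl fun v _ => ?_
  rw [mul_smul_comm, mul_left_comm]

lemma polyKoszul_mem {I : Ideal (MvPolynomial σ 𝕜)} {c : Finset σ → MvPolynomial σ 𝕜}
    (hc : ∀ T, c T ∈ I) (U : Finset σ) : polyKoszul c U ∈ I := by
  rw [polyKoszul, koszulDifferential_apply]
  exact sum_mem fun v _ => zsmul_mem (I.mul_mem_left _ (hc _)) _

lemma polyKoszul_polyKoszul (c : Finset σ → MvPolynomial σ 𝕜) :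
    polyKoszul (polyKoszul c) = 0 :=
  koszulDifferential_koszulDifferential c

lemma IsKoszulChain.polyKoszul {i d : ℕ} {c : Finset σ → MvPolynomial σ 𝕜}
    (hc : IsKoszulChain (i + 1) d c) : IsKoszulChain i (d + 1) (polyKoszul c) := by
  intro T
  rw [_root_.polyKoszul, koszulDifferential_apply]
  constructor
  · refine IsHomogeneous.sum _ _ _ fun v _ => ?_
    have h : ((X v : MvPolynomial σ 𝕜) * c (insert v T)).IsHomogeneous (d + 1) :=
      (hc.X_mul v (insert v T)).1
    rw [← mem_homogeneousSubmodule] at h ⊢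
    exact zsmul_mem h _
  · intro hT
    refine Finset.sum_eq_zero fun v hv => ?_
    rw [(hc _).2, smul_zero, smul_zero]
    rw [Finset.card_insert_of_notMem (Finset.mem_compl.mp hv)]
    omega

/-- Chains of homological degree `0` are cycles. -/
lemma polyKoszul_eq_zero {d : ℕ} {c : Finset σ → MvPolynomial σ 𝕜}
    (hc : IsKoszulChain 0 d c) (U : Finset σ) : polyKoszul c U = 0 := by
  rw [polyKoszul, koszulDifferential_apply]
  refine Finset.sum_eq_zero fun v hv => ?_
  rw [(hc _).2, smul_zero, smul_zero]
  simp

/-- Multiplication by a variable is null-homotopic on the Koszul complex. -/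
lemma polyKoszul_koszulHomotopy (x : σ) (c : Finset σ → MvPolynomial σ 𝕜) (U : Finset σ) :
    polyKoszul (koszulHomotopy x c) U + koszulHomotopy x (polyKoszul c) U = X x * c U := by
  have hsq : ∀ n : ℕ, (-1 : ℤ) ^ n * (-1) ^ n = 1 := fun n => by
    rw [← mul_pow]; simp
  by_cases hx : x ∈ U
  · have hc : (U.erase x)ᶜ = insert x Uᶜ := by
      ext u; by_cases h : u = x <;> simp [h, hx]
    have h2 : koszulHomotopy x (polyKoszul c) U = X x * c U + ∑ v ∈ Uᶜ,
        ((-1 : ℤ) ^ (U.filter (· < x)).card * (-1) ^ ((U.erase x).filter (· < v)).card) •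
          (X v * c (insert v (U.erase x))) := by
      rw [koszulHomotopy, if_pos hx, polyKoszul, koszulDifferential_apply, hc,
        Finset.sum_insert (by simpa using hx), smul_add, smul_smul, filter_lt_erase, hsq, one_smul,
        Finset.insert_erase hx, Finset.smul_sum]
      simp only [smul_smul, smul_eq_mul]
    rw [h2, polyKoszul, koszulDifferential_apply, add_left_comm, ← Finset.sum_add_distrib,
      Finset.sum_eq_zero, add_zero]
    intro v hv
    have hvU : v ∉ U := Finset.mem_compl.mp hv
    have hvx : v ≠ x := fun h => hvU (h ▸ hx)
    rw [koszulHomotopy, if_pos (Finset.mem_insert_of_mem hx), smul_eq_mul, mul_smul_comm, smul_smul,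
      Finset.erase_insert_of_ne hvx, ← add_smul]
    convert zero_smul ℤ _ using 2
    rcases lt_or_gt_of_ne hvx with h | h
    · have e1 : ((insert v U).filter (· < x)).card = (U.filter (· < x)).card + 1 := by
        rw [Finset.filter_insert, if_pos h, Finset.card_insert_of_notMem (by simp [hvU])]
      have e2 : (U.erase x).filter (· < v) = U.filter (· < v) := by
        rw [Finset.filter_erase, Finset.erase_eq_of_notMem]
        simp [h.le]
      rw [e1, e2]; ring
    · have e1 : (insert v U).filter (· < x) = U.filter (· < x) := by
        rw [Finset.filter_insert, if_neg (not_lt.mpr h.le)]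
      have e2 : (U.filter (· < v)).card = ((U.erase x).filter (· < v)).card + 1 := by
        rw [Finset.filter_erase, Finset.card_erase_add_one]
        simp [hx, h]
      rw [e1, e2]; ring
  · rw [koszulHomotopy, if_neg hx, add_zero, polyKoszul, koszulDifferential_apply,
      Finset.sum_eq_single x]
    · rw [koszulHomotopy, if_pos (Finset.mem_insert_self _ _), Finset.erase_insert hx,
        Finset.filter_insert, if_neg (lt_irrefl x), smul_eq_mul, mul_smul_comm, smul_smul, hsq,
        one_smul]
    · intro v _ hvx
      rw [koszulHomotopy, if_neg (by simp [hvx.symm, hx]), smul_zero, smul_zero]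
    · intro h
      exact absurd (Finset.mem_compl.mpr hx) h

end Chains

/-! ### Vanishing of Koszul homology above a line -/

section Regularity

variable {σ 𝕜 : Type*} [Field 𝕜]

attribute [local instance] MvPolynomial.gradedAlgebra

lemma homogeneousComponent_X_mul (y : σ) (p : MvPolynomial σ 𝕜) (d : ℕ) :
    homogeneousComponent (d + 1) (X y * p) = X y * homogeneousComponent d p := by
  classical
  ext m
  rw [coeff_homogeneousComponent, coeff_X_mul', coeff_X_mul', coeff_homogeneousComponent]
  by_cases hm : y ∈ m.support
  · have h : (m - Finsupp.single y 1).degree + 1 = m.degree := by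
      have h1 : m - Finsupp.single y 1 + Finsupp.single y 1 = m :=
        tsub_add_cancel_of_le (by
          rw [Finsupp.single_le_iff]
          exact Nat.one_le_iff_ne_zero.mpr (Finsupp.mem_support_iff.mp hm))
      conv_rhs => rw [← h1]
      simp
    simp only [if_pos hm, ← h, add_left_inj]
  · simp only [if_neg hm, ite_self]

/-- A homogeneous element of a sum of homogeneous ideals splits into homogeneous parts. -/
lemma exists_isHomogeneous_mem_sub_mem {P Q : Ideal (MvPolynomial σ 𝕜)}
    (hP : P.IsHomogeneous (homogeneousSubmodule σ 𝕜))
    (hQ : Q.IsHomogeneous (homogeneousSubmodule σ 𝕜)) {d : ℕ} {f : MvPolynomial σ 𝕜}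
    (hf : f.IsHomogeneous d) (hfPQ : f ∈ P ⊔ Q) :
    ∃ p ∈ P, p.IsHomogeneous d ∧ f - p ∈ Q := by
  obtain ⟨p, hp, q, hq, rfl⟩ := Submodule.mem_sup.mp hfPQ
  refine ⟨homogeneousComponent d p, homogeneousComponent_mem_of_mem hP hp d,
    homogeneousComponent_isHomogeneous _ _, ?_⟩
  rw [← homogeneousComponent_eq_self hf, map_add, add_sub_cancel_left]
  exact homogeneousComponent_mem_of_mem hQ hq d

lemma exists_isHomogeneous_sub_X_mul_mem {L : Ideal (MvPolynomial σ 𝕜)}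
    (hL : L.IsHomogeneous (homogeneousSubmodule σ 𝕜)) {y : σ} {d : ℕ} {f : MvPolynomial σ 𝕜}
    (hf : f.IsHomogeneous (d + 1)) (hfL : f ∈ L ⊔ Ideal.span {X y}) :
    ∃ e : MvPolynomial σ 𝕜, e.IsHomogeneous d ∧ f - X y * e ∈ L := by
  obtain ⟨l, hl, q, hq, rfl⟩ := Submodule.mem_sup.mp hfL
  obtain ⟨e, rfl⟩ := Ideal.mem_span_singleton'.mp hq
  refine ⟨homogeneousComponent d e, homogeneousComponent_isHomogeneous _ _, ?_⟩
  rw [← homogeneousComponent_eq_self hf, map_add, mul_comm e, homogeneousComponent_X_mul,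
    add_sub_cancel_right]
  exact homogeneousComponent_mem_of_mem hL hl _

lemma IsKoszulChain.exists_mem_sub_mem {P Q : Ideal (MvPolynomial σ 𝕜)}
    (hP : P.IsHomogeneous (homogeneousSubmodule σ 𝕜))
    (hQ : Q.IsHomogeneous (homogeneousSubmodule σ 𝕜)) {i d : ℕ}
    {c : Finset σ → MvPolynomial σ 𝕜} (hc : IsKoszulChain i d c) (hcPQ : ∀ T, c T ∈ P ⊔ Q) :
    ∃ p, IsKoszulChain i d p ∧ (∀ T, p T ∈ P) ∧ ∀ T, c T - p T ∈ Q := by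
  classical
  choose p hpP hpd hpQ using fun T =>
    exists_isHomogeneous_mem_sub_mem hP hQ (hc T).1 (hcPQ T)
  refine ⟨fun T => if T.card = i then p T else 0, fun T => ⟨?_, fun h => if_neg h⟩,
    fun T => ?_, fun T => ?_⟩ <;> dsimp only <;> split_ifs with h
  · exact hpd T
  · exact isHomogeneous_zero _ _ _
  · exact hpP T
  · exact P.zero_mem
  · exact hpQ T
  · rw [(hc T).2 h, sub_zero]
    exact Q.zero_mem

lemma IsKoszulChain.exists_sub_X_mul_mem {L : Ideal (MvPolynomial σ 𝕜)}
    (hL : L.IsHomogeneous (homogeneousSubmodule σ 𝕜)) {y : σ} {i d : ℕ}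
    {c : Finset σ → MvPolynomial σ 𝕜} (hc : IsKoszulChain i (d + 1) c)
    (hcL : ∀ T, c T ∈ L ⊔ Ideal.span {X y}) :
    ∃ e, IsKoszulChain i d e ∧ ∀ T, c T - X y * e T ∈ L := by
  classical
  choose e hed heL using fun T => exists_isHomogeneous_sub_X_mul_mem hL (hc T).1 (hcL T)
  refine ⟨fun T => if T.card = i then e T else 0, fun T => ⟨?_, fun h => if_neg h⟩,
    fun T => ?_⟩ <;> dsimp only <;> split_ifs with h
  · exact hed T
  · exact isHomogeneous_zero _ _ _
  · exact heL T
  · rw [(hc T).2 h, mul_zero, sub_zero]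
    exact L.zero_mem

variable [Fintype σ] [LinearOrder σ]

/-- The Koszul homology of `S ⧸ I` vanishes in homological degree `i` and internal degree `j`
whenever `j - i > r`, i.e. `reg (S ⧸ I) ≤ r`. Chains with values in `S ⧸ I` are represented by
chains with values in `S`, and equalities by congruences modulo `I`. -/
def RegLE (I : Ideal (MvPolynomial σ 𝕜)) (r : ℕ) : Prop :=
  ∀ (i d : ℕ) (c : Finset σ → MvPolynomial σ 𝕜), r ≤ d → IsKoszulChain i (d + 1) c →
    (∀ T, polyKoszul c T ∈ I) →
    ∃ b, IsKoszulChain (i + 1) d b ∧ ∀ T, c T - polyKoszul b T ∈ I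

lemma RegLE.mono {I : Ideal (MvPolynomial σ 𝕜)} {r s : ℕ} (h : RegLE I r) (hrs : r ≤ s) :
    RegLE I s :=
  fun i d c hd => h i d c (hrs.trans hd)

/-- The exact sequence `0 → S/(P ∩ Q) → S/P ⊕ S/Q → S/(P + Q) → 0`. -/
lemma RegLE.inf {P Q : Ideal (MvPolynomial σ 𝕜)} {r : ℕ}
    (hP : P.IsHomogeneous (homogeneousSubmodule σ 𝕜))
    (hQ : Q.IsHomogeneous (homogeneousSubmodule σ 𝕜))
    (h1 : RegLE P (r + 1)) (h2 : RegLE Q (r + 1)) (h3 : RegLE (P ⊔ Q) r) :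
    RegLE (P ⊓ Q) (r + 1) := by
  intro i d c hd hc hcI
  obtain ⟨b₁, hb₁, hc₁⟩ := h1 i d c hd hc fun T => (hcI T).1
  obtain ⟨b₂, hb₂, hc₂⟩ := h2 i d c hd hc fun T => (hcI T).2
  obtain ⟨d, rfl⟩ : ∃ e, d = e + 1 := ⟨d - 1, by omega⟩
  obtain ⟨e, he, hbe⟩ := h3 (i + 1) d (b₁ - b₂) (by omega) (hb₁.sub hb₂) fun T => by
    have := sub_mem (Ideal.mem_sup_right (hc₂ T) : _ ∈ P ⊔ Q) (Ideal.mem_sup_left (hc₁ T))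
    rw [polyKoszul_sub]
    convert this using 1
    simp only [Pi.sub_apply]
    ring
  obtain ⟨p, hp, hpP, hpQ⟩ := ((hb₁.sub hb₂).sub he.polyKoszul).exists_mem_sub_mem hP hQ hbe
  refine ⟨b₁ - p, hb₁.sub hp, fun T => Submodule.mem_inf.mpr ⟨?_, ?_⟩⟩
  · have := add_mem (hc₁ T) (polyKoszul_mem hpP T)
    rw [polyKoszul_sub]
    convert this using 1
    simp only [Pi.sub_apply]
    ring
  · -- modulo `Q` the chain `b₁ - p` agrees with `b₂` up to the boundary of `e`
    have := sub_mem (hc₂ T)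
      (polyKoszul_mem (c := b₁ - b₂ - polyKoszul e - p) hpQ T)
    simp only [polyKoszul_sub, polyKoszul_polyKoszul, Pi.sub_apply, Pi.zero_apply] at this ⊢
    convert this using 1
    ring

/-- The exact sequence `0 → (S/(L : y))(-1) → S/L → S/(L + (y)) → 0` for a variable `y`. -/
lemma RegLE.of_colon {L Q : Ideal (MvPolynomial σ 𝕜)} {y : σ} {r : ℕ}
    (hL : L.IsHomogeneous (homogeneousSubmodule σ 𝕜)) (hLQ : ∀ p, X y * p ∈ L ↔ p ∈ Q)
    (h1 : RegLE Q r) (h2 : RegLE (L ⊔ Ideal.span {X y}) (r + 1)) : RegLE L (r + 1) := by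
  intro i d c hd hc hcI
  obtain ⟨b, hb, hcb⟩ := h2 i d c hd hc fun T => Ideal.mem_sup_left (hcI T)
  obtain ⟨d, rfl⟩ : ∃ e, d = e + 1 := ⟨d - 1, by omega⟩
  obtain ⟨e, he, hce⟩ := (hc.sub hb.polyKoszul).exists_sub_X_mul_mem hL hcb
  have hdiff : ∀ T, polyKoszul c T - X y * polyKoszul e T ∈ L := fun T => by
    have := polyKoszul_mem (c := c - polyKoszul b - fun T => X y * e T) hce T
    simp only [polyKoszul_sub, polyKoszul_polyKoszul, polyKoszul_mul, sub_zero] at this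
    exact this
  obtain ⟨b', hb', heb'⟩ := h1 i d e (by omega) he fun T =>
    (hLQ _).mp ((Submodule.sub_mem_iff_right _ (hcI T)).mp (hdiff T))
  refine ⟨b + fun T => X y * b' T, hb.add (hb'.X_mul y), fun T => ?_⟩
  have := add_mem (hce T) ((hLQ _).mpr (heb' T))
  simp only [polyKoszul_add, polyKoszul_mul, Pi.add_apply, Pi.sub_apply] at this ⊢
  convert this using 1
  ring

/-- Adding a nonzerodivisor `x` of degree one does not increase the regularity. -/
lemma RegLE.sup_span_X {L : Ideal (MvPolynomial σ 𝕜)} {x : σ} {r : ℕ}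
    (hL : L.IsHomogeneous (homogeneousSubmodule σ 𝕜)) (hx : ∀ p, X x * p ∈ L → p ∈ L)
    (h : RegLE L r) : RegLE (L ⊔ Ideal.span {X x}) r := by
  intro i d c hd hc hcI
  obtain _ | i := i
  · obtain ⟨b, hb, hcb⟩ := h 0 d c hd hc fun T => by
      rw [polyKoszul_eq_zero hc]; exact L.zero_mem
    exact ⟨b, hb, fun T => Ideal.mem_sup_left (hcb T)⟩
  obtain ⟨e, he, hce⟩ := hc.polyKoszul.exists_sub_X_mul_mem hL hcI
  obtain ⟨b, hb, heb⟩ := h i d e hd he fun T => hx _ <| by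
    have := polyKoszul_mem (c := polyKoszul c - fun T => X x * e T) hce T
    simpa only [polyKoszul_sub, polyKoszul_polyKoszul, polyKoszul_mul, zero_sub, Pi.neg_apply,
      neg_mem_iff] using this
  obtain ⟨b', hb', hcb'⟩ := h (i + 1) d (c - fun T => X x * b T) hd (hc.sub (hb.X_mul x))
    fun T => by
      have := add_mem (hce T) (L.mul_mem_left (X x) (heb T))
      simp only [polyKoszul_sub, polyKoszul_mul, Pi.sub_apply]
      convert this using 1
      ring
  refine ⟨b', hb', fun T => ?_⟩
  have h1 : X x * b T ∈ L ⊔ Ideal.span {X x} :=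
    Ideal.mem_sup_right (Ideal.mul_mem_right _ _ (Ideal.mem_span_singleton_self _))
  have := add_mem (Ideal.mem_sup_left (hcb' T) : _ ∈ L ⊔ Ideal.span {X x}) h1
  convert this using 1
  simp only [Pi.sub_apply]
  ring

/-- The regularity can be computed modulo a nonzerodivisor of degree one, since multiplication by a
variable is null-homotopic. -/
lemma RegLE.of_sup_span_X {L : Ideal (MvPolynomial σ 𝕜)} {x : σ} {r : ℕ}
    (hL : L.IsHomogeneous (homogeneousSubmodule σ 𝕜)) (hx : ∀ p, X x * p ∈ L → p ∈ L)
    (h : RegLE (L ⊔ Ideal.span {X x}) r) : RegLE L r := by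
  intro i d c hd hc hcI
  obtain ⟨b, hb, hcb⟩ := h i d c hd hc fun T => Ideal.mem_sup_left (hcI T)
  obtain ⟨e, he, hce⟩ := (hc.sub hb.polyKoszul).exists_sub_X_mul_mem hL hcb
  have heL : ∀ T, polyKoszul e T ∈ L := fun T => hx _ <| by
    have := polyKoszul_mem (c := c - polyKoszul b - fun T => X x * e T) hce T
    simp only [polyKoszul_sub, polyKoszul_polyKoszul, polyKoszul_mul, sub_zero] at this
    exact (Submodule.sub_mem_iff_right _ (hcI T)).mp this
  refine ⟨b + koszulHomotopy x e, hb.add (he.koszulHomotopy x), fun T => ?_⟩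
  have := add_mem (hce T) (koszulHomotopy_mem heL x T)
  simp only [polyKoszul_add, ← polyKoszul_koszulHomotopy, Pi.add_apply, Pi.sub_apply] at this ⊢
  convert this using 1
  ring

end Regularity

/-! ### Comparison with the Castelnuovo-Mumford regularity -/

/-- Cycles with values in `S ⧸ I` lift to chains with values in `S`, so `RegLE` bounds the
regularity. -/
lemma RegLE.cmRegularity_le {σ 𝕜 : Type*} [Field 𝕜] [Fintype σ] [LinearOrder σ]
    {I : Ideal (MvPolynomial σ 𝕜)} {r : ℕ} (h : RegLE I r) :
    cmRegularity σ (quotientGrading I) ≤ (((r : ℤ) : WithTop ℤ) : WithBot (WithTop ℤ)) := by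
  refine iSup_le fun i => iSup_le fun j => iSup_le fun hij => ?_
  rw [WithBot.coe_le_coe, WithTop.coe_le_coe]
  by_contra! hlt
  apply hij
  suffices hle : koszulCycles σ (quotientGrading I) i j ≤
      koszulBoundaries σ (quotientGrading I) i j by
    have : Subsingleton (gradedTor σ (quotientGrading I) i j) :=
      Submodule.Quotient.subsingleton_iff.mpr (Submodule.submoduleOf_eq_top.mpr hle)
    exact Module.finrank_zero_of_subsingleton
  rintro c ⟨hc, hc0⟩
  obtain ⟨d, hd⟩ : ∃ d : ℕ, j - i = Int.ofNat (d + 1) :=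
    ⟨(j - i - 1).toNat, by simp only [Int.ofNat_eq_natCast]; omega⟩
  have hmk : ∀ (f : Finset σ → MvPolynomial σ 𝕜) (T : Finset σ),
      koszulDifferential σ 𝕜 (MvPolynomial σ 𝕜 ⧸ I) (fun U => Ideal.Quotient.mk I (f U)) T =
        Ideal.Quotient.mk I (polyKoszul f T) := fun f T => by
    rw [polyKoszul, koszulDifferential_apply, koszulDifferential_apply, map_sum]
    refine Finset.sum_congr rfl fun v _ => ?_
    rw [map_zsmul]
    rfl
  have hlift : ∀ T, ∃ f : MvPolynomial σ 𝕜, f.IsHomogeneous (d + 1) ∧ (T.card ≠ i → f = 0) ∧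
      Ideal.Quotient.mk I f = c T := fun T => by
    by_cases hT : T.card = i
    · have h1 := (hc T).1
      rw [hd] at h1
      obtain ⟨f, hf, hfc⟩ := h1
      exact ⟨f, hf, fun h => absurd hT h, hfc⟩
    · exact ⟨0, isHomogeneous_zero _ _ _, fun _ => rfl, by rw [(hc T).2 hT, map_zero]⟩
  choose f hf1 hf2 hf3 using hlift
  have hfc : c = fun T => Ideal.Quotient.mk I (f T) := funext fun T => (hf3 T).symm
  obtain ⟨b, hb, hfb⟩ := h i d f (by simp only [Int.ofNat_eq_natCast] at hd; omega)
    (fun T => ⟨hf1 T, hf2 T⟩) fun T => by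
      rw [← Ideal.Quotient.eq_zero_iff_mem, ← hmk, ← hfc]
      exact congrFun hc0 T
  refine ⟨fun T => Ideal.Quotient.mk I (b T), fun T => ⟨?_, fun hT => ?_⟩, ?_⟩
  · have hd' : j - ((i + 1 : ℕ) : ℤ) = Int.ofNat d := by
      simp only [Int.ofNat_eq_natCast] at hd ⊢; omega
    rw [hd']
    exact ⟨b T, (hb T).1, rfl⟩
  · simp only [(hb T).2 hT, map_zero]
  · funext T
    rw [hmk, ← hf3 T, eq_comm, Ideal.Quotient.eq]
    exact hfb T

/-! ### Ideals that do not involve some of the variables -/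

section FreeOf

variable {σ 𝕜 : Type*} [Field 𝕜]

attribute [local instance] MvPolynomial.gradedAlgebra

/-- The homogeneous ideal `I` has generators in the variables outside of `U`, i.e. `I` is extended
from the polynomial ring in those variables. -/
def FreeOf (U : Set σ) (I : Ideal (MvPolynomial σ 𝕜)) : Prop :=
  ∃ g : Set (MvPolynomial σ 𝕜), I = Ideal.span g ∧
    ∀ p ∈ g, (∃ n, p.IsHomogeneous n) ∧ ∀ u ∈ p.vars, u ∉ U

lemma FreeOf.isHomogeneous {U : Set σ} {I : Ideal (MvPolynomial σ 𝕜)} (h : FreeOf U I) :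
    I.IsHomogeneous (homogeneousSubmodule σ 𝕜) := by
  obtain ⟨g, rfl, hg⟩ := h
  exact Ideal.homogeneous_span _ _ fun p hp => (hg p hp).1

lemma FreeOf.mono {U U' : Set σ} {I : Ideal (MvPolynomial σ 𝕜)} (h : FreeOf U I) (hU : U' ⊆ U) :
    FreeOf U' I := by
  obtain ⟨g, rfl, hg⟩ := h
  exact ⟨g, rfl, fun p hp => ⟨(hg p hp).1, fun u hu hu' => (hg p hp).2 u hu (hU hu')⟩⟩

lemma FreeOf.sup {U : Set σ} {I J : Ideal (MvPolynomial σ 𝕜)} (hI : FreeOf U I)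
    (hJ : FreeOf U J) : FreeOf U (I ⊔ J) := by
  obtain ⟨g, rfl, hg⟩ := hI
  obtain ⟨g', rfl, hg'⟩ := hJ
  refine ⟨g ∪ g', (Ideal.span_union g g').symm, ?_⟩
  rintro p (hp | hp)
  exacts [hg p hp, hg' p hp]

lemma freeOf_bot (U : Set σ) : FreeOf U (⊥ : Ideal (MvPolynomial σ 𝕜)) :=
  ⟨∅, Ideal.span_empty.symm, by simp⟩

lemma freeOf_span_X {U T : Set σ} (h : Disjoint T U) :
    FreeOf U (Ideal.span (X '' T) : Ideal (MvPolynomial σ 𝕜)) := by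
  refine ⟨_, rfl, ?_⟩
  rintro _ ⟨t, ht, rfl⟩
  refine ⟨⟨1, isHomogeneous_X 𝕜 t⟩, fun u hu => ?_⟩
  rw [vars_X, Finset.mem_singleton] at hu
  exact hu ▸ Set.disjoint_left.mp h ht

/-- Ring homomorphisms that agree on the variables outside of `U` agree on the generators of an ideal
that does not involve `U`. -/
lemma FreeOf.le_comap {U : Set σ} {I : Ideal (MvPolynomial σ 𝕜)} (h : FreeOf U I) {R : Type*}
    [CommRing R] {f f' : MvPolynomial σ 𝕜 →+* R} (hC : f.comp C = f'.comp C)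
    (hX : ∀ u ∉ U, f (X u) = f' (X u)) {K : Ideal R} (hK : I ≤ K.comap f') : I ≤ K.comap f := by
  obtain ⟨g, rfl, hg⟩ := h
  refine Ideal.span_le.mpr fun p hp => ?_
  have h1 : f p = f' p := hom_congr_vars hC (fun u hu _ => hX u ((hg p hp).2 u hu)) rfl
  have h2 : f' p ∈ K := hK (Ideal.subset_span hp)
  rw [← h1] at h2
  exact h2

/-- A variable that `I` does not involve is a nonzerodivisor modulo `I`, as `S ⧸ I` is a polynomial
ring in this variable. -/
lemma FreeOf.mem_of_X_mul_mem {U : Set σ} {I : Ideal (MvPolynomial σ 𝕜)} (h : FreeOf U I) {u : σ}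
    (hu : u ∈ U) {p : MvPolynomial σ 𝕜} (hp : X u * p ∈ I) : p ∈ I := by
  classical
  let R := MvPolynomial σ 𝕜 ⧸ I
  let θ : MvPolynomial σ 𝕜 →+* MvPolynomial Unit R :=
    eval₂Hom (C.comp ((Ideal.Quotient.mk I).comp C))
      fun v => if v = u then X () else C (Ideal.Quotient.mk I (X v))
  let ρ : MvPolynomial Unit R →+* R :=
    eval₂Hom (RingHom.id R) fun _ => Ideal.Quotient.mk I (X u)
  have hρθ : ρ.comp θ = Ideal.Quotient.mk I := by
    ext v
    · simp [ρ, θ]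
    · by_cases hv : v = u <;> simp [ρ, θ, hv]
  have hI : I ≤ (⊥ : Ideal (MvPolynomial Unit R)).comap θ := by
    refine h.le_comap (R := MvPolynomial Unit R) (f' := C.comp (Ideal.Quotient.mk I)) ?_ ?_ ?_
    · ext a; simp [θ]
    · intro v hv
      have : v ≠ u := fun h => hv (h ▸ hu)
      simp [θ, this]
    · intro q hq
      simp [Ideal.Quotient.eq_zero_iff_mem.mpr hq]
  have h0 : θ (X u * p) = 0 := hI hp
  have h1 : θ p = 0 := by
    have h2 : (X () : MvPolynomial Unit R) * θ p = X () * 0 := by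
      rw [mul_zero, ← h0, map_mul]
      simp [θ]
    exact X_mul_cancel_left_iff.mp h2
  rw [← Ideal.Quotient.eq_zero_iff_mem, ← hρθ, RingHom.comp_apply, h1, map_zero]

lemma sup_span_X_insert [DecidableEq σ] (I : Ideal (MvPolynomial σ 𝕜)) (u : σ) (T : Finset σ) :
    I ⊔ Ideal.span (X '' (↑(insert u T) : Set σ)) =
      I ⊔ Ideal.span (X '' (T : Set σ)) ⊔ Ideal.span {X u} := by
  rw [Finset.coe_insert, Set.image_insert_eq, Ideal.span_insert, sup_assoc,
    sup_comm (Ideal.span {X u})]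

variable [Fintype σ] [LinearOrder σ]

/-- Variables that `I` does not involve form a regular sequence modulo `I`, so adding them to `I` does
not change the regularity. -/
lemma FreeOf.regLE_sup_span_X_iff {U : Set σ} {I : Ideal (MvPolynomial σ 𝕜)} (h : FreeOf U I)
    {T : Set σ} (hT : T ⊆ U) {r : ℕ} :
    RegLE (I ⊔ Ideal.span (X '' T)) r ↔ RegLE I r := by
  lift T to Finset σ using T.toFinite
  induction T using Finset.induction_on with
  | empty => simp
  | insert u T hu ih =>
    rw [Finset.coe_insert, Set.insert_subset_iff] at hT
    have hfree : FreeOf {u} (I ⊔ Ideal.span (X '' (T : Set σ))) :=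
      (h.mono (Set.singleton_subset_iff.mpr hT.1)).sup
        (freeOf_span_X (Set.disjoint_singleton_right.mpr (by simpa using hu)))
    have hnzd := fun p => hfree.mem_of_X_mul_mem (p := p) (Set.mem_singleton u)
    rw [sup_span_X_insert, ← ih hT.2]
    exact ⟨fun h' => h'.of_sup_span_X hfree.isHomogeneous hnzd,
      fun h' => h'.sup_span_X hfree.isHomogeneous hnzd⟩

variable (σ 𝕜) in
/-- The polynomial ring has regularity `0`. -/
lemma regLE_bot : RegLE (⊥ : Ideal (MvPolynomial σ 𝕜)) 0 := by
  rw [← (freeOf_bot Set.univ).regLE_sup_span_X_iff (T := Set.univ) (Set.subset_univ _)]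
  -- modulo all variables, there are no nonzero chains with coefficients of positive degree
  intro i d c _ hc _
  refine ⟨0, IsKoszulChain.zero _ _, fun T => Ideal.mem_sup_right ?_⟩
  have h0 : polyKoszul (0 : Finset σ → MvPolynomial σ 𝕜) = 0 := map_zero _
  rw [h0, Pi.zero_apply, sub_zero, mem_ideal_span_X_image]
  intro m hm
  have hdeg := (hc T).1.degree_eq_sum_deg_support hm
  by_contra! hall
  rw [Finset.sum_eq_zero] at hdeg
  · omega
  · exact fun v _ => hall v (by simp)

end FreeOf

/-! ### The generic `2 × n` matrix -/

section Toric

variable {ι R : Type*} [CommRing R]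

variable (ι R) in
/-- The ideal of `2`-minors of the generic matrix with rows `(x_i)` and `(y_i)`. -/
noncomputable def minorIdeal : Ideal (MvPolynomial (ι ⊕ ι) R) :=
  Ideal.span {p | ∃ i j : ι, p = X (Sum.inl i) * X (Sum.inr j) - X (Sum.inr i) * X (Sum.inl j)}

/-- The exponent of the image of a variable under `x_i ↦ s z_i`, `y_i ↦ z_i`; the variable `s` is
indexed by `none`. -/
noncomputable def segreExp : ι ⊕ ι → (Option ι →₀ ℕ) :=
  Sum.elim (fun i => Finsupp.single none 1 + Finsupp.single (some i) 1)
    fun i => Finsupp.single (some i) 1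

/-- The exponent of the image of a monomial under `x_i ↦ s z_i`, `y_i ↦ z_i`. -/
noncomputable def segreExpHom : (ι ⊕ ι →₀ ℕ) →ₗ[ℕ] (Option ι →₀ ℕ) :=
  Finsupp.linearCombination ℕ segreExp

lemma segreExpHom_single_add (v : ι ⊕ ι) (m : ι ⊕ ι →₀ ℕ) :
    segreExpHom (Finsupp.single v 1 + m) = segreExp v + segreExpHom m := by
  simp [segreExpHom]

lemma exists_of_segreExpHom_ne_zero {m : ι ⊕ ι →₀ ℕ} {a : Option ι} (h : segreExpHom m a ≠ 0) :
    ∃ v, m v ≠ 0 ∧ segreExp v a ≠ 0 := by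
  rw [segreExpHom, Finsupp.linearCombination_apply, Finsupp.sum, Finsupp.finsetSum_apply] at h
  obtain ⟨v, hv, h⟩ := Finset.exists_ne_zero_of_sum_ne_zero h
  rw [Finsupp.smul_apply, smul_eq_mul] at h
  exact ⟨v, left_ne_zero_of_mul h, right_ne_zero_of_mul h⟩

lemma Finsupp.exists_eq_single_add {α : Type*} {m : α →₀ ℕ} {v : α} (h : m v ≠ 0) :
    ∃ n, m = Finsupp.single v 1 + n := by
  refine ⟨m - Finsupp.single v 1, (add_tsub_cancel_of_le ?_).symm⟩
  rw [Finsupp.single_le_iff]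
  exact Nat.one_le_iff_ne_zero.mpr h

/-- Monomials with the same image under `x_i ↦ s z_i`, `y_i ↦ z_i` are congruent modulo the
`2`-minors. If both contain a common variable, it can be cancelled; otherwise an exchange
`x_j y_i ↦ x_i y_j` creates one. -/
lemma monomial_sub_monomial_mem_minorIdeal (m m' : ι ⊕ ι →₀ ℕ)
    (h : segreExpHom m = segreExpHom m') :
    (monomial m 1 - monomial m' 1 : MvPolynomial (ι ⊕ ι) R) ∈ minorIdeal ι R := by
  induction hk : m.degree generalizing m m' with
  | zero =>
    have hm : m = 0 := (Finsupp.degree_eq_zero_iff m).mp hk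
    subst hm
    by_cases hm' : m' = 0
    · simp [hm']
    · obtain ⟨v, hv⟩ := Finsupp.ne_iff.mp hm'
      obtain ⟨n, rfl⟩ := Finsupp.exists_eq_single_add hv
      rw [segreExpHom_single_add, map_zero] at h
      obtain ⟨i, rfl⟩ | ⟨i, rfl⟩ : (∃ i, v = Sum.inl i) ∨ ∃ i, v = Sum.inr i := by
        cases v <;> simp
      all_goals
        have := DFunLike.congr_fun h (some i)
        simp [segreExp] at this
        omega
  | succ k ih =>
    have common : ∀ v n n', (Finsupp.single v 1 + n).degree = k + 1 →
        segreExpHom (Finsupp.single v 1 + n) = segreExpHom (Finsupp.single v 1 + n') →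
        (monomial (Finsupp.single v 1 + n) 1 - monomial (Finsupp.single v 1 + n') 1 :
          MvPolynomial (ι ⊕ ι) R) ∈ minorIdeal ι R := fun v n n' hn hnn' => by
      rw [segreExpHom_single_add, segreExpHom_single_add] at hnn'
      have h1 := ih n n' (add_left_cancel hnn') (by simp at hn; omega)
      have h2 := Ideal.mul_mem_left _ (X v) h1
      rwa [mul_sub, X, monomial_mul, monomial_mul, one_mul] at h2
    by_cases hx : ∃ i, m (Sum.inl i) ≠ 0
    · obtain ⟨i, hi⟩ := hx
      obtain ⟨n, rfl⟩ := Finsupp.exists_eq_single_add hi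
      by_cases hi' : m' (Sum.inl i) ≠ 0
      · obtain ⟨n', rfl⟩ := Finsupp.exists_eq_single_add hi'
        exact common _ _ _ hk h
      · have hnone : segreExpHom m' none ≠ 0 := by
          rw [← h, segreExpHom_single_add]; simp [segreExp]
        have hsome : segreExpHom m' (some i) ≠ 0 := by
          rw [← h, segreExpHom_single_add]; simp [segreExp]
        obtain ⟨v, hv, hv'⟩ := exists_of_segreExpHom_ne_zero hsome
        obtain ⟨n₁, rfl⟩ := Finsupp.exists_eq_single_add hv
        obtain rfl : v = Sum.inr i := by
          rcases v with j | j
          · have : j = i := by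
              by_contra hji
              simp [segreExp, hji] at hv'
            subst this
            exact absurd hv hi'
          · have : j = i := by
              by_contra hji
              simp [segreExp, hji] at hv'
            rw [this]
        obtain ⟨w, hw, hw'⟩ := exists_of_segreExpHom_ne_zero hnone
        rcases w with j | j
        swap
        · simp [segreExp] at hw'
        have hn₁ : n₁ (Sum.inl j) ≠ 0 := by simpa using hw
        obtain ⟨n₂, rfl⟩ := Finsupp.exists_eq_single_add hn₁
        have e1 := common (Sum.inl i) n (Finsupp.single (Sum.inr j) 1 + n₂) hk <| by
          rw [h]
          simp only [segreExpHom_single_add, segreExp, Sum.elim_inl, Sum.elim_inr]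
          abel
        have e2 : (monomial (Finsupp.single (Sum.inl i) 1 + (Finsupp.single (Sum.inr j) 1 + n₂)) 1 -
            monomial (Finsupp.single (Sum.inr i) 1 + (Finsupp.single (Sum.inl j) 1 + n₂)) 1 :
            MvPolynomial (ι ⊕ ι) R) ∈ minorIdeal ι R := by
          have : (X (Sum.inl i) * X (Sum.inr j) - X (Sum.inr i) * X (Sum.inl j) :
              MvPolynomial (ι ⊕ ι) R) ∈ minorIdeal ι R := Ideal.subset_span ⟨i, j, rfl⟩
          have := Ideal.mul_mem_right (monomial n₂ 1) _ this
          simpa only [sub_mul, mul_assoc, X, monomial_mul, one_mul, add_assoc] using this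
        have := add_mem e1 e2
        rwa [sub_add_sub_cancel] at this
    · push Not at hx
      have hm0 : m ≠ 0 := by rintro rfl; simp at hk
      obtain ⟨v, hv⟩ := Finsupp.ne_iff.mp hm0
      rcases v with i | i
      · exact absurd (hx i) hv
      have hnone : ¬ segreExpHom m none ≠ 0 := fun h0 => by
        obtain ⟨w, hw, hw'⟩ := exists_of_segreExpHom_ne_zero h0
        rcases w with j | j
        · exact hw (hx j)
        · simp [segreExp] at hw'
      obtain ⟨n, rfl⟩ := Finsupp.exists_eq_single_add hv
      have hsome : segreExpHom m' (some i) ≠ 0 := by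
        rw [← h, segreExpHom_single_add]; simp [segreExp]
      obtain ⟨w, hw, hw'⟩ := exists_of_segreExpHom_ne_zero hsome
      obtain ⟨n', rfl⟩ := Finsupp.exists_eq_single_add hw
      rcases w with j | j
      · refine absurd ?_ hnone
        rw [h, segreExpHom_single_add]
        simp [segreExp]
      · have : j = i := by
          by_contra hji
          simp [segreExp, hji] at hw'
        subst this
        exact common _ _ _ hk h

variable (ι R) in
/-- The map `x_i ↦ s z_i`, `y_i ↦ z_i`. -/
noncomputable def segreMap : MvPolynomial (ι ⊕ ι) R →ₐ[R] MvPolynomial (Option ι) R :=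
  aeval fun v => monomial (segreExp v) 1

lemma segreMap_monomial (m : ι ⊕ ι →₀ ℕ) (a : R) :
    segreMap ι R (monomial m a) = monomial (segreExpHom m) a := by
  induction m using Finsupp.induction_linear generalizing a with
  | zero => simp [segreMap, ← C_apply]
  | add m n hm hn =>
    rw [← mul_one a, ← monomial_mul, map_mul, hm, hn, monomial_mul, map_add]
  | single v k =>
    rw [← C_mul_X_pow_eq_monomial, map_mul, map_pow]
    simp [segreMap, segreExpHom, monomial_pow, C_mul_monomial]

/-- The ideal of `2`-minors is the kernel of the parametrization of the Segre variety. -/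
lemma ker_segreMap : RingHom.ker (segreMap ι R) = minorIdeal ι R := by
  classical
  apply le_antisymm
  · intro p hp
    -- a linear map inverting the parametrization on monomials, up to elements of the ideal
    let ψ : MvPolynomial (Option ι) R →ₗ[R] MvPolynomial (ι ⊕ ι) R ⧸ minorIdeal ι R :=
      (basisMonomials (Option ι) R).constr R fun e =>
        if h : ∃ m, segreExpHom m = e then Ideal.Quotient.mk _ (monomial h.choose 1) else 0
    have hψ : ψ ∘ₗ (segreMap ι R).toLinearMap =
        (Ideal.Quotient.mkₐ R (minorIdeal ι R)).toLinearMap := by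
      refine (basisMonomials (ι ⊕ ι) R).ext fun m => ?_
      have h : ∃ m', segreExpHom m' = segreExpHom m := ⟨m, rfl⟩
      have h1 : ψ (monomial (segreExpHom m) 1) = Ideal.Quotient.mk _ (monomial h.choose 1) := by
        have := (basisMonomials (Option ι) R).constr_basis R (fun e =>
          if h : ∃ m, segreExpHom m = e then (Ideal.Quotient.mk (minorIdeal ι R)
            (monomial h.choose 1)) else 0) (segreExpHom m)
        rw [dif_pos h, coe_basisMonomials] at this
        exact this
      rw [coe_basisMonomials, LinearMap.comp_apply, AlgHom.toLinearMap_apply, segreMap_monomial, h1,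
        AlgHom.toLinearMap_apply, Ideal.Quotient.mkₐ_eq_mk, Ideal.Quotient.eq]
      exact monomial_sub_monomial_mem_minorIdeal _ _ h.choose_spec
    have := LinearMap.congr_fun hψ p
    rw [LinearMap.comp_apply, AlgHom.toLinearMap_apply, RingHom.mem_ker.mp hp, map_zero,
      AlgHom.toLinearMap_apply, Ideal.Quotient.mkₐ_eq_mk, eq_comm] at this
    exact Ideal.Quotient.eq_zero_iff_mem.mp this
  · refine Ideal.span_le.mpr ?_
    rintro _ ⟨i, j, rfl⟩
    rw [SetLike.mem_coe, RingHom.mem_ker, X, X, X, X, monomial_mul, monomial_mul, map_sub,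
      segreMap_monomial, segreMap_monomial, sub_eq_zero, map_add, map_add]
    simp only [segreExpHom, Finsupp.linearCombination_single, one_smul, one_mul, segreExp,
      Sum.elim_inl, Sum.elim_inr]
    rw [add_right_comm, add_comm (Finsupp.single (some i) 1)]

/-- The variables `x_i` are nonzerodivisors modulo the `2`-minors. -/
lemma mem_minorIdeal_of_X_mul_mem {i : ι} {p : MvPolynomial (ι ⊕ ι) R}
    (h : X (Sum.inl i) * p ∈ minorIdeal ι R) : p ∈ minorIdeal ι R := by
  rw [← ker_segreMap, RingHom.mem_ker, map_mul, X, segreMap_monomial] at h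
  rw [← ker_segreMap, RingHom.mem_ker]
  rw [← mul_zero (monomial _ 1), monomial_one_mul_cancel_left_iff] at h
  exact h

end Toric

/-! ### Ideals of `2`-minors indexed by pairs of vertices -/

section PairIdeal

variable {𝕜 V : Type*} [Field 𝕜]

variable (𝕜) in
/-- The minor `x_i y_j - y_i x_j`. -/
noncomputable def pairMinor (i j : V) : MvPolynomial (BEIVar V) 𝕜 :=
  X (Sum.inlₗ i) * X (Sum.inrₗ j) - X (Sum.inrₗ i) * X (Sum.inlₗ j)

variable (𝕜) in
/-- The ideal generated by the minors `x_i y_j - y_i x_j` with `(i, j) ∈ s`. -/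
noncomputable def pairIdeal (s : Set (V × V)) : Ideal (MvPolynomial (BEIVar V) 𝕜) :=
  Ideal.span {p | ∃ i j : V, (i, j) ∈ s ∧ p = pairMinor 𝕜 i j}

/-- The variables `x_i`, `y_i` with `i ∈ W`. -/
def vertexVars (W : Set V) : Set (BEIVar V) :=
  {u | Sum.elim id id (ofLex u) ∈ W}

variable (𝕜) in
/-- The ideal generated by the variables `x_i`, `y_i` with `i ∈ W`. -/
noncomputable def varIdeal (W : Set V) : Ideal (MvPolynomial (BEIVar V) 𝕜) :=
  Ideal.span (X '' vertexVars W)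

@[simp] lemma inlₗ_mem_vertexVars {W : Set V} {i : V} :
    (Sum.inlₗ i : BEIVar V) ∈ vertexVars W ↔ i ∈ W := Iff.rfl

@[simp] lemma inrₗ_mem_vertexVars {W : Set V} {i : V} :
    (Sum.inrₗ i : BEIVar V) ∈ vertexVars W ↔ i ∈ W := Iff.rfl

lemma BEIVar.cases (u : BEIVar V) : (∃ i, u = Sum.inlₗ i) ∨ ∃ i, u = Sum.inrₗ i := by
  rcases h : ofLex u with i | i
  · exact Or.inl ⟨i, h⟩
  · exact Or.inr ⟨i, h⟩

lemma vertexVars_mono {W W' : Set V} (h : W ⊆ W') : vertexVars W ⊆ vertexVars W' :=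
  fun _ hu => h hu

lemma disjoint_vertexVars {W W' : Set V} (h : Disjoint W W') :
    Disjoint (vertexVars W) (vertexVars W') :=
  Disjoint.preimage _ h

lemma X_mem_varIdeal {W : Set V} {u : BEIVar V} (hu : u ∈ vertexVars W) : X u ∈ varIdeal 𝕜 W :=
  Ideal.subset_span ⟨u, hu, rfl⟩

lemma varIdeal_le_iff {W : Set V} {J : Ideal (MvPolynomial (BEIVar V) 𝕜)} :
    varIdeal 𝕜 W ≤ J ↔ ∀ u ∈ vertexVars W, X u ∈ J := by
  rw [varIdeal, Ideal.span_le, Set.image_subset_iff]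
  rfl

lemma pairMinor_mem {s : Set (V × V)} {i j : V} (h : (i, j) ∈ s) :
    pairMinor 𝕜 i j ∈ pairIdeal 𝕜 s :=
  Ideal.subset_span ⟨i, j, h, rfl⟩

lemma pairIdeal_le_iff {s : Set (V × V)} {J : Ideal (MvPolynomial (BEIVar V) 𝕜)} :
    pairIdeal 𝕜 s ≤ J ↔ ∀ i j, (i, j) ∈ s → pairMinor 𝕜 i j ∈ J := by
  rw [pairIdeal, Ideal.span_le]
  refine ⟨fun h i j hij => h ⟨i, j, hij, rfl⟩, ?_⟩
  rintro h _ ⟨i, j, hij, rfl⟩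
  exact h i j hij

lemma pairIdeal_mono {s t : Set (V × V)} (h : s ⊆ t) : pairIdeal 𝕜 s ≤ pairIdeal 𝕜 t :=
  pairIdeal_le_iff.mpr fun _ _ hij => pairMinor_mem (h hij)

lemma pairIdeal_union (s t : Set (V × V)) :
    pairIdeal 𝕜 (s ∪ t) = pairIdeal 𝕜 s ⊔ pairIdeal 𝕜 t := by
  refine le_antisymm (pairIdeal_le_iff.mpr ?_)
    (sup_le (pairIdeal_mono Set.subset_union_left) (pairIdeal_mono Set.subset_union_right))
  rintro i j (h | h)
  exacts [Ideal.mem_sup_left (pairMinor_mem h), Ideal.mem_sup_right (pairMinor_mem h)]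

lemma binomialEdgeIdeal_eq_pairIdeal (G : SimpleGraph V) :
    binomialEdgeIdeal 𝕜 G = pairIdeal 𝕜 {p | G.Adj p.1 p.2} := rfl

lemma pairMinor_mem_of_left {J : Ideal (MvPolynomial (BEIVar V) 𝕜)} {i j : V}
    (h1 : X (Sum.inlₗ i) ∈ J) (h2 : X (Sum.inrₗ i) ∈ J) : pairMinor 𝕜 i j ∈ J :=
  sub_mem (Ideal.mul_mem_right _ _ h1) (Ideal.mul_mem_right _ _ h2)

lemma pairMinor_mem_of_right {J : Ideal (MvPolynomial (BEIVar V) 𝕜)} {i j : V}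
    (h1 : X (Sum.inlₗ j) ∈ J) (h2 : X (Sum.inrₗ j) ∈ J) : pairMinor 𝕜 i j ∈ J :=
  sub_mem (Ideal.mul_mem_left _ _ h2) (Ideal.mul_mem_left _ _ h1)

lemma freeOf_pairIdeal {s : Set (V × V)} {W : Set V} (h : ∀ i j, (i, j) ∈ s → i ∉ W ∧ j ∉ W) :
    FreeOf (vertexVars W) (pairIdeal 𝕜 s) := by
  classical
  refine ⟨_, rfl, ?_⟩
  rintro _ ⟨i, j, hij, rfl⟩
  refine ⟨⟨2, ((isHomogeneous_X 𝕜 _).mul (isHomogeneous_X 𝕜 _)).sub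
    ((isHomogeneous_X 𝕜 _).mul (isHomogeneous_X 𝕜 _))⟩, fun u hu => ?_⟩
  obtain ⟨hi, hj⟩ := h i j hij
  have h1 := vars_sub_subset _ hu
  rcases Finset.mem_union.mp h1 with h2 | h2 <;>
  · rcases Finset.mem_union.mp (vars_mul _ _ h2) with h3 | h3 <;>
    · rw [vars_X, Finset.mem_singleton] at h3
      subst h3
      simpa

lemma freeOf_varIdeal {W W' : Set V} (h : Disjoint W W') :
    FreeOf (vertexVars W') (varIdeal 𝕜 W) :=
  freeOf_span_X (disjoint_vertexVars h)

/-- The ideal `pairIdeal 𝕜 s` is homogeneous. -/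
lemma freeOf_empty_pairIdeal (s : Set (V × V)) : FreeOf ∅ (pairIdeal 𝕜 s) :=
  (freeOf_pairIdeal (W := ∅) fun _ _ _ => ⟨id, id⟩).mono (Set.empty_subset _)

/-- The ideal `pairIdeal 𝕜 s ⊔ I` is homogeneous. -/
lemma FreeOf.pairIdeal_sup {U : Set (BEIVar V)} {I : Ideal (MvPolynomial (BEIVar V) 𝕜)}
    (hI : FreeOf U I) (s : Set (V × V)) : FreeOf ∅ (pairIdeal 𝕜 s ⊔ I) :=
  (freeOf_empty_pairIdeal s).sup (hI.mono (Set.empty_subset _))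

/-- Base change of `mem_minorIdeal_of_X_mul_mem` to the coefficient ring `S ⧸ I`. -/
lemma FreeOf.mem_of_X_mul_mem_complete {W : Set V} {I : Ideal (MvPolynomial (BEIVar V) 𝕜)}
    (hI : FreeOf (vertexVars W) I) {w : V} (hw : w ∈ W) {p : MvPolynomial (BEIVar V) 𝕜}
    (hp : X (Sum.inlₗ w) * p ∈ pairIdeal 𝕜 (W ×ˢ W) ⊔ I) : p ∈ pairIdeal 𝕜 (W ×ˢ W) ⊔ I := by
  classical
  let R := MvPolynomial (BEIVar V) 𝕜 ⧸ I
  let K := pairIdeal 𝕜 (W ×ˢ W) ⊔ I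
  let θ : MvPolynomial (BEIVar V) 𝕜 →+* MvPolynomial (W ⊕ W) R :=
    eval₂Hom (C.comp ((Ideal.Quotient.mk I).comp C)) fun u => Sum.elim
      (fun i => if h : i ∈ W then X (Sum.inl ⟨i, h⟩) else C (Ideal.Quotient.mk I (X u)))
      (fun i => if h : i ∈ W then X (Sum.inr ⟨i, h⟩) else C (Ideal.Quotient.mk I (X u))) (ofLex u)
  have θl : ∀ i (h : i ∈ W), θ (X (Sum.inlₗ i)) = X (Sum.inl ⟨i, h⟩) := fun i h => by
    simp [θ, h]
  have θr : ∀ i (h : i ∈ W), θ (X (Sum.inrₗ i)) = X (Sum.inr ⟨i, h⟩) := fun i h => by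
    simp [θ, h]
  have θo : ∀ u ∉ vertexVars W, θ (X u) = C (Ideal.Quotient.mk I (X u)) := fun u hu => by
    obtain ⟨i, rfl⟩ | ⟨i, rfl⟩ := BEIVar.cases u
    · have h : i ∉ W := hu
      simp [θ, h]
    · have h : i ∉ W := hu
      simp [θ, h]
  have θC : ∀ a, θ (C a) = C (Ideal.Quotient.mk I (C a)) := fun a => by simp [θ]
  let ρ : MvPolynomial (W ⊕ W) R →+* MvPolynomial (BEIVar V) 𝕜 ⧸ K :=
    eval₂Hom (Ideal.Quotient.factor (le_sup_right : I ≤ K)) (Sum.elim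
      (fun i => Ideal.Quotient.mk K (X (Sum.inlₗ i.1)))
      (fun i => Ideal.Quotient.mk K (X (Sum.inrₗ i.1))))
  have ρl : ∀ i : W, ρ (X (Sum.inl i)) = Ideal.Quotient.mk K (X (Sum.inlₗ i.1)) := fun i => by
    simp [ρ]
  have ρr : ∀ i : W, ρ (X (Sum.inr i)) = Ideal.Quotient.mk K (X (Sum.inrₗ i.1)) := fun i => by
    simp [ρ]
  have ρC : ∀ q, ρ (C (Ideal.Quotient.mk I q)) = Ideal.Quotient.mk K q := fun q => by
    simp only [ρ, coe_eval₂Hom, eval₂_C]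
    exact Ideal.Quotient.factor_mk _ _
  have hρθ : ρ.comp θ = Ideal.Quotient.mk K := by
    ext u
    · simp [θC, ρC]
    · rw [RingHom.comp_apply]
      by_cases hu : u ∈ vertexVars W
      · obtain ⟨i, rfl⟩ | ⟨i, rfl⟩ := BEIVar.cases u
        · rw [θl i hu, ρl]
        · rw [θr i hu, ρr]
      · rw [θo u hu, ρC]
  have hθ : K ≤ (minorIdeal W R).comap θ := by
    refine sup_le (pairIdeal_le_iff.mpr ?_) ?_
    · rintro i j ⟨hi, hj⟩
      rw [Ideal.mem_comap, pairMinor, map_sub, map_mul, map_mul, θl i hi, θl j hj, θr i hi, θr j hj]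
      exact Ideal.subset_span ⟨_, _, rfl⟩
    · refine hI.le_comap (R := MvPolynomial (W ⊕ W) R) (f' := C.comp (Ideal.Quotient.mk I))
        ?_ θo ?_
      · ext a; simp [θC]
      · intro q hq
        simp [Ideal.Quotient.eq_zero_iff_mem.mpr hq]
  have hρ : minorIdeal W R ≤ RingHom.ker ρ := by
    refine Ideal.span_le.mpr ?_
    rintro _ ⟨i, j, rfl⟩
    rw [SetLike.mem_coe, RingHom.mem_ker, map_sub, map_mul, map_mul, ρl, ρl, ρr, ρr, ← map_mul,
      ← map_mul, ← map_sub, Ideal.Quotient.eq_zero_iff_mem]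
    exact Ideal.mem_sup_left (pairMinor_mem ⟨i.2, j.2⟩)
  have h1 : θ (X (Sum.inlₗ w) * p) ∈ minorIdeal W R := hθ hp
  rw [map_mul, θl w hw] at h1
  have h2 := hρ (mem_minorIdeal_of_X_mul_mem h1)
  rw [RingHom.mem_ker, ← RingHom.comp_apply, hρθ] at h2
  exact Ideal.Quotient.eq_zero_iff_mem.mp h2

lemma pairIdeal_insert_sup_varIdeal (w : V) (W : Set V) :
    pairIdeal 𝕜 (insert w W ×ˢ insert w W) ⊔ varIdeal 𝕜 {w} =
      pairIdeal 𝕜 (W ×ˢ W) ⊔ varIdeal 𝕜 {w} := by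
  have hx : (X (Sum.inlₗ w) : MvPolynomial (BEIVar V) 𝕜) ∈
      pairIdeal 𝕜 (W ×ˢ W) ⊔ varIdeal 𝕜 {w} :=
    Ideal.mem_sup_right (X_mem_varIdeal (by simp))
  have hy : (X (Sum.inrₗ w) : MvPolynomial (BEIVar V) 𝕜) ∈
      pairIdeal 𝕜 (W ×ˢ W) ⊔ varIdeal 𝕜 {w} :=
    Ideal.mem_sup_right (X_mem_varIdeal (by simp))
  refine le_antisymm (sup_le (pairIdeal_le_iff.mpr ?_) le_sup_right)
    (sup_le_sup_right (pairIdeal_mono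
      (Set.prod_mono (Set.subset_insert _ _) (Set.subset_insert _ _))) _)
  rintro i j ⟨rfl | hi, hj⟩
  · exact pairMinor_mem_of_left hx hy
  · obtain rfl | hj := hj
    · exact pairMinor_mem_of_right hx hy
    · exact Ideal.mem_sup_left (pairMinor_mem ⟨hi, hj⟩)

lemma varIdeal_singleton (w : V) :
    varIdeal 𝕜 {w} = Ideal.span {X (Sum.inlₗ w)} ⊔ Ideal.span {X (Sum.inrₗ w)} := by
  refine le_antisymm (varIdeal_le_iff.mpr fun u hu => ?_) (sup_le ?_ ?_)
  · obtain ⟨i, rfl⟩ | ⟨i, rfl⟩ := BEIVar.cases u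
    · obtain rfl : i = w := hu
      exact Ideal.mem_sup_left (Ideal.mem_span_singleton_self _)
    · obtain rfl : i = w := hu
      exact Ideal.mem_sup_right (Ideal.mem_span_singleton_self _)
  · rw [Ideal.span_singleton_le_iff_mem]
    exact X_mem_varIdeal (by simp)
  · rw [Ideal.span_singleton_le_iff_mem]
    exact X_mem_varIdeal (by simp)

/-- Completing one side `W₁` of a join of graphs on `W₁` and `W₂`: the ideal of the join is the
intersection of the ideal with `W₁` completed and the ideal obtained by killing the variables of
`W₂`. -/
lemma pairIdeal_join_eq_inf {W₁ W₂ : Set V} (hd : Disjoint W₁ W₂) {s t : Set (V × V)}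
    (hs : s ⊆ W₁ ×ˢ W₁) (ht : t ⊆ W₂ ×ˢ W₂) {I : Ideal (MvPolynomial (BEIVar V) 𝕜)}
    (hI : FreeOf (vertexVars W₂) I) :
    pairIdeal 𝕜 (s ∪ (t ∪ (W₁ ×ˢ W₂ ∪ W₂ ×ˢ W₁))) ⊔ I =
      (pairIdeal 𝕜 (W₁ ×ˢ W₁ ∪ (t ∪ (W₁ ×ˢ W₂ ∪ W₂ ×ˢ W₁))) ⊔ I) ⊓
        (pairIdeal 𝕜 s ⊔ (varIdeal 𝕜 W₂ ⊔ I)) := by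
  classical
  set N := t ∪ (W₁ ×ˢ W₂ ∪ W₂ ×ˢ W₁) with hN
  set Q := pairIdeal 𝕜 s ⊔ (varIdeal 𝕜 W₂ ⊔ I) with hQ
  have hxy : ∀ i ∈ W₂, (X (Sum.inlₗ i) : MvPolynomial (BEIVar V) 𝕜) ∈ Q ∧ X (Sum.inrₗ i) ∈ Q :=
    fun i hi => ⟨Ideal.mem_sup_right (Ideal.mem_sup_left (X_mem_varIdeal hi)),
      Ideal.mem_sup_right (Ideal.mem_sup_left (X_mem_varIdeal hi))⟩
  have hNQ : pairIdeal 𝕜 N ⊔ I ≤ Q := by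
    refine sup_le (pairIdeal_le_iff.mpr ?_) (le_sup_right.trans le_sup_right)
    rintro i j (h | ⟨-, h⟩ | ⟨h, -⟩)
    · exact pairMinor_mem_of_left (hxy i (ht h).1).1 (hxy i (ht h).1).2
    · exact pairMinor_mem_of_right (hxy j h).1 (hxy j h).2
    · exact pairMinor_mem_of_left (hxy i h).1 (hxy i h).2
  simp only [pairIdeal_union _ N, sup_assoc]
  apply le_antisymm
  · exact le_inf (sup_le_sup_right (pairIdeal_mono hs) _) (sup_le le_sup_left hNQ)
  rintro p ⟨hp1, hp2⟩
  obtain ⟨k, hk, n, hn, rfl⟩ := Submodule.mem_sup.mp hp1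
  have hkQ : k ∈ Q := (Submodule.add_mem_iff_left _ (hNQ hn)).mp hp2
  refine add_mem ?_ (Ideal.mem_sup_right hn)
  -- the endomorphism that kills the variables of `W₂`
  let ε : MvPolynomial (BEIVar V) 𝕜 →+* MvPolynomial (BEIVar V) 𝕜 :=
    eval₂Hom C fun u => if u ∈ vertexVars W₂ then 0 else X u
  have εC : ∀ a, ε (C a) = C a := fun a => by simp [ε]
  have ε0 : ∀ u ∈ vertexVars W₂, ε (X u) = 0 := fun u hu => by simp [ε, hu]
  have ε1 : ∀ u ∉ vertexVars W₂, ε (X u) = X u := fun u hu => by simp [ε, hu]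
  have hεminor : ∀ i ∈ W₁, ∀ j ∈ W₁, ε (pairMinor 𝕜 i j) = pairMinor 𝕜 i j := fun i hi j hj => by
    have hi' := Set.disjoint_left.mp hd hi
    have hj' := Set.disjoint_left.mp hd hj
    simp only [pairMinor, map_sub, map_mul]
    rw [ε1 (Sum.inlₗ i) hi', ε1 (Sum.inrₗ i) hi', ε1 (Sum.inlₗ j) hj', ε1 (Sum.inrₗ j) hj']
  have hεQ : Q ≤ (pairIdeal 𝕜 s ⊔ I).comap ε := by
    refine sup_le (pairIdeal_le_iff.mpr fun i j hij => ?_) (sup_le (varIdeal_le_iff.mpr ?_) ?_)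
    · rw [Ideal.mem_comap, hεminor i (hs hij).1 j (hs hij).2]
      exact Ideal.mem_sup_left (pairMinor_mem hij)
    · intro u hu
      rw [Ideal.mem_comap, ε0 u hu]
      exact Ideal.zero_mem _
    · refine hI.le_comap (f' := RingHom.id _) ?_ ε1 le_sup_right
      ext a; simp [εC]
  have hε : ∀ q, q - ε q ∈ varIdeal 𝕜 W₂ := fun q => by
    have : (Ideal.Quotient.mk (varIdeal 𝕜 W₂)).comp ε = Ideal.Quotient.mk (varIdeal 𝕜 W₂) := by
      ext u
      · simp [εC]
      · rw [RingHom.comp_apply]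
        by_cases hu : u ∈ vertexVars W₂
        · rw [ε0 u hu, map_zero, eq_comm, Ideal.Quotient.eq_zero_iff_mem]
          exact X_mem_varIdeal hu
        · rw [ε1 u hu]
    rw [← Ideal.Quotient.eq, ← RingHom.comp_apply, this]
  -- Plücker relations: multiples of minors of `W₁` by variables of `W₂`
  have hcross : ∀ v ∈ varIdeal 𝕜 W₂, ∀ i ∈ W₁, ∀ j ∈ W₁,
      v * pairMinor 𝕜 i j ∈ pairIdeal 𝕜 N := by
    intro v hv i hi j hj
    have hl : ∀ w ∈ W₂, pairMinor 𝕜 w i ∈ pairIdeal 𝕜 N ∧ pairMinor 𝕜 w j ∈ pairIdeal 𝕜 N :=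
      fun w hw => ⟨pairMinor_mem (Or.inr (Or.inr ⟨hw, hi⟩)),
        pairMinor_mem (Or.inr (Or.inr ⟨hw, hj⟩))⟩
    refine Submodule.span_induction (p := fun v _ => v * pairMinor 𝕜 i j ∈ pairIdeal 𝕜 N)
      ?_ ?_ ?_ ?_ hv
    · rintro _ ⟨u, hu, rfl⟩
      obtain ⟨w, rfl⟩ | ⟨w, rfl⟩ := BEIVar.cases u
      · have := sub_mem (Ideal.mul_mem_left _ (X (Sum.inlₗ i)) (hl w hu).2)
          (Ideal.mul_mem_left _ (X (Sum.inlₗ j)) (hl w hu).1)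
        convert this using 1
        simp only [pairMinor]
        ring
      · have := sub_mem (Ideal.mul_mem_left _ (X (Sum.inrₗ i)) (hl w hu).2)
          (Ideal.mul_mem_left _ (X (Sum.inrₗ j)) (hl w hu).1)
        convert this using 1
        simp only [pairMinor]
        ring
    · rw [zero_mul]; exact Ideal.zero_mem _
    · intro a b _ _ ha hb
      rw [add_mul]; exact add_mem ha hb
    · intro a b _ hb
      rw [smul_eq_mul, mul_assoc]
      exact Ideal.mul_mem_left _ _ hb
  have hkε : k - ε k ∈ pairIdeal 𝕜 N := by
    suffices h : ∀ a, a * k - ε (a * k) ∈ pairIdeal 𝕜 N by simpa using h 1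
    refine Submodule.span_induction (p := fun k _ => ∀ a, a * k - ε (a * k) ∈ pairIdeal 𝕜 N)
      ?_ ?_ ?_ ?_ hk
    · rintro _ ⟨i, j, ⟨hi, hj⟩, rfl⟩ a
      rw [map_mul, hεminor i hi j hj, ← sub_mul]
      exact hcross _ (hε a) i hi j hj
    · intro a
      rw [mul_zero, map_zero, sub_zero]; exact Ideal.zero_mem _
    · intro k k' _ _ hk hk' a
      rw [mul_add, map_add, add_sub_add_comm]
      exact add_mem (hk a) (hk' a)
    · intro b k _ hk a
      rw [smul_eq_mul, ← mul_assoc]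
      exact hk (a * b)
  have hεk : ε k ∈ pairIdeal 𝕜 s ⊔ I := hεQ hkQ
  have hle : pairIdeal 𝕜 s ⊔ I ≤ pairIdeal 𝕜 s ⊔ (pairIdeal 𝕜 N ⊔ I) :=
    sup_le_sup_left le_sup_right _
  have := add_mem (Ideal.mem_sup_right (Ideal.mem_sup_left hkε) :
    _ ∈ pairIdeal 𝕜 s ⊔ (pairIdeal 𝕜 N ⊔ I)) (hle hεk)
  rwa [sub_add_cancel] at this

variable [Fintype V] [LinearOrder V]

lemma FreeOf.regLE_varIdeal_sup {W W' : Set V} {I : Ideal (MvPolynomial (BEIVar V) 𝕜)}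
    (hI : FreeOf (vertexVars W') I) (hW : W ⊆ W') {r : ℕ} (h : RegLE I r) :
    RegLE (varIdeal 𝕜 W ⊔ I) r := by
  rw [sup_comm]
  exact (hI.regLE_sup_span_X_iff (vertexVars_mono hW)).mpr h

/-- The `2`-minors of a generic `2 × n` matrix have regularity at most `1`. Cut down by the
nonzerodivisor `x_w`; then multiplication by `y_w` splits the quotient into one by variables only
and one with a smaller matrix. -/
lemma FreeOf.regLE_complete {W : Set V} {I : Ideal (MvPolynomial (BEIVar V) 𝕜)}
    (hI : FreeOf (vertexVars W) I) {r : ℕ} (h : RegLE I r) :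
    RegLE (pairIdeal 𝕜 (W ×ˢ W) ⊔ I) (r + 1) := by
  lift W to Finset V using W.toFinite
  induction W using Finset.induction_on generalizing I with
  | empty =>
    have : pairIdeal 𝕜 (((∅ : Finset V) : Set V) ×ˢ ((∅ : Finset V) : Set V)) = ⊥ :=
      le_bot_iff.mp (pairIdeal_le_iff.mpr fun i j hij => by simp at hij)
    rw [this, bot_sup_eq]
    exact h.mono (Nat.le_succ r)
  | insert w W hw ih =>
    rw [Finset.coe_insert] at hI ⊢
    set K := pairIdeal 𝕜 (insert w (W : Set V) ×ˢ insert w (W : Set V)) with hK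
    have hw' : w ∈ insert w (W : Set V) := Set.mem_insert _ _
    refine RegLE.of_sup_span_X (x := Sum.inlₗ w) (hI.pairIdeal_sup _).isHomogeneous
      (fun p hp => hI.mem_of_X_mul_mem_complete hw' hp) ?_
    have hx : FreeOf ∅ (Ideal.span {X (Sum.inlₗ w)} : Ideal (MvPolynomial (BEIVar V) 𝕜)) := by
      rw [← Set.image_singleton]
      exact freeOf_span_X (Set.disjoint_empty _)
    set T : Set (BEIVar V) := {u | ∃ i ∈ insert w (W : Set V), u = Sum.inlₗ i} with hT
    have hTU : T ⊆ vertexVars (insert w (W : Set V)) := by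
      rintro _ ⟨i, hi, rfl⟩; exact hi
    have hTX : ∀ i ∈ insert w (W : Set V), (X (Sum.inlₗ i) : MvPolynomial (BEIVar V) 𝕜) ∈
        I ⊔ Ideal.span (X '' T) := fun i hi =>
      Ideal.mem_sup_right (Ideal.subset_span ⟨_, ⟨i, hi, rfl⟩, rfl⟩)
    have hQfree : FreeOf {Sum.inrₗ w} (I ⊔ Ideal.span (X '' T)) := by
      refine (hI.mono (Set.singleton_subset_iff.mpr hw')).sup (freeOf_span_X ?_)
      rw [Set.disjoint_singleton_right]
      rintro ⟨i, -, hi⟩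
      cases hi
    refine RegLE.of_colon (y := Sum.inrₗ w) (Q := I ⊔ Ideal.span (X '' T))
      ((hI.pairIdeal_sup _).sup hx).isHomogeneous (fun p => ⟨fun hp => ?_, fun hp => ?_⟩)
      ((hI.regLE_sup_span_X_iff hTU).mpr h) ?_
    · suffices hLQ : K ⊔ I ⊔ Ideal.span {X (Sum.inlₗ w)} ≤ I ⊔ Ideal.span (X '' T) from
        hQfree.mem_of_X_mul_mem (Set.mem_singleton _) (hLQ hp)
      refine sup_le (sup_le (pairIdeal_le_iff.mpr ?_) le_sup_left) ?_
      · rintro i j ⟨hi, hj⟩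
        exact sub_mem (Ideal.mul_mem_right _ _ (hTX i hi)) (Ideal.mul_mem_left _ _ (hTX j hj))
      · rw [Ideal.span_singleton_le_iff_mem]
        exact hTX w hw'
    · revert p
      rw [← Ideal.span_singleton_mul_le_iff, Ideal.mul_sup]
      have hIL : I ≤ K ⊔ I ⊔ Ideal.span {X (Sum.inlₗ w)} :=
        le_sup_of_le_left le_sup_right
      refine sup_le (le_trans Ideal.mul_le_right hIL) ?_
      rw [Ideal.span_mul_span', Ideal.span_le]
      rintro _ ⟨_, rfl, _, ⟨_, ⟨i, hi, rfl⟩, rfl⟩, rfl⟩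
      have h1 : pairMinor 𝕜 w i ∈ K ⊔ I ⊔ Ideal.span {X (Sum.inlₗ w)} :=
        Ideal.mem_sup_left (Ideal.mem_sup_left (pairMinor_mem ⟨hw', hi⟩))
      have h2 : (X (Sum.inlₗ w) : MvPolynomial (BEIVar V) 𝕜) ∈
          K ⊔ I ⊔ Ideal.span {X (Sum.inlₗ w)} :=
        Ideal.mem_sup_right (Ideal.mem_span_singleton_self _)
      have h3 := sub_mem (Ideal.mul_mem_left _ (X (Sum.inrₗ i)) h2) h1
      rw [pairMinor, mul_comm (X (Sum.inrₗ i)), sub_sub_cancel] at h3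
      exact h3
    · have : K ⊔ I ⊔ Ideal.span {X (Sum.inlₗ w)} ⊔ Ideal.span {X (Sum.inrₗ w)} =
          pairIdeal 𝕜 ((W : Set V) ×ˢ (W : Set V)) ⊔ (varIdeal 𝕜 {w} ⊔ I) := by
        rw [sup_assoc, ← varIdeal_singleton, sup_right_comm, hK, pairIdeal_insert_sup_varIdeal,
          sup_assoc]
      rw [this]
      exact ih (hI.regLE_varIdeal_sup (by simp) h)
        ((freeOf_varIdeal (by simpa using hw)).sup
          (hI.mono (vertexVars_mono (Set.subset_insert _ _))))

/-- One half of the bound for a join: the side `W₁` may be completed. -/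
lemma FreeOf.regLE_join_of_complete {W₁ W₂ : Set V} (hd : Disjoint W₁ W₂) {s t : Set (V × V)}
    (hs : s ⊆ W₁ ×ˢ W₁) (ht : t ⊆ W₂ ×ˢ W₂) {I : Ideal (MvPolynomial (BEIVar V) 𝕜)}
    (hI : FreeOf (vertexVars (W₁ ∪ W₂)) I) {r n : ℕ} (hrn : r + 2 ≤ n) (h : RegLE I r)
    (h1 : RegLE (pairIdeal 𝕜 s ⊔ (varIdeal 𝕜 W₂ ⊔ I)) n)
    (h2 : RegLE (pairIdeal 𝕜 (W₁ ×ˢ W₁ ∪ (t ∪ (W₁ ×ˢ W₂ ∪ W₂ ×ˢ W₁))) ⊔ I) n) :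
    RegLE (pairIdeal 𝕜 (s ∪ (t ∪ (W₁ ×ˢ W₂ ∪ W₂ ×ˢ W₁))) ⊔ I) n := by
  have hI₁ := hI.mono (vertexVars_mono Set.subset_union_left)
  have hI₂ := hI.mono (vertexVars_mono Set.subset_union_right)
  have hvar : FreeOf (vertexVars W₁) (varIdeal 𝕜 W₂ ⊔ I) := (freeOf_varIdeal hd.symm).sup hI₁
  obtain ⟨n, rfl⟩ : ∃ m, n = m + 1 := ⟨n - 1, by omega⟩
  rw [pairIdeal_join_eq_inf hd hs ht hI₂]
  refine h2.inf (hI.pairIdeal_sup _).isHomogeneous (hvar.pairIdeal_sup s).isHomogeneous h1 ?_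
  have hsup : pairIdeal 𝕜 (W₁ ×ˢ W₁ ∪ (t ∪ (W₁ ×ˢ W₂ ∪ W₂ ×ˢ W₁))) ⊔ I ⊔
      (pairIdeal 𝕜 s ⊔ (varIdeal 𝕜 W₂ ⊔ I)) =
      pairIdeal 𝕜 (W₁ ×ˢ W₁) ⊔ (varIdeal 𝕜 W₂ ⊔ I) := by
    apply le_antisymm
    · have hxy : ∀ i ∈ W₂, (X (Sum.inlₗ i) : MvPolynomial (BEIVar V) 𝕜) ∈ varIdeal 𝕜 W₂ ∧
          X (Sum.inrₗ i) ∈ varIdeal 𝕜 W₂ := fun i hi => ⟨X_mem_varIdeal hi, X_mem_varIdeal hi⟩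
      have hN : pairIdeal 𝕜 (t ∪ (W₁ ×ˢ W₂ ∪ W₂ ×ˢ W₁)) ≤ varIdeal 𝕜 W₂ := by
        rw [pairIdeal_le_iff]
        rintro i j (h | ⟨-, h⟩ | ⟨h, -⟩)
        · exact pairMinor_mem_of_left (hxy i (ht h).1).1 (hxy i (ht h).1).2
        · exact pairMinor_mem_of_right (hxy j h).1 (hxy j h).2
        · exact pairMinor_mem_of_left (hxy i h).1 (hxy i h).2
      rw [pairIdeal_union]
      exact sup_le (sup_le (sup_le le_sup_left (le_sup_of_le_right (le_sup_of_le_left hN)))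
        (le_sup_of_le_right le_sup_right)) (sup_le_sup_right (pairIdeal_mono hs) _)
    · exact sup_le (le_sup_of_le_left (le_sup_of_le_left (pairIdeal_mono Set.subset_union_left)))
        (le_sup_of_le_right le_sup_right)
  rw [hsup]
  exact (hvar.regLE_complete (hI.regLE_varIdeal_sup Set.subset_union_right h)).mono (by omega)

/-- The regularity of the ideal of a join of graphs on `W₁` and `W₂` is at most the maximum of those
of the two graphs and `2`; here all ideals are taken modulo an ideal `I` in the other variables. -/
lemma FreeOf.regLE_join {W₁ W₂ : Set V} (hd : Disjoint W₁ W₂) {s t : Set (V × V)}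
    (hs : s ⊆ W₁ ×ˢ W₁) (ht : t ⊆ W₂ ×ˢ W₂) {I : Ideal (MvPolynomial (BEIVar V) 𝕜)}
    (hI : FreeOf (vertexVars (W₁ ∪ W₂)) I) {r n : ℕ} (hrn : r + 2 ≤ n) (h : RegLE I r)
    (h1 : RegLE (pairIdeal 𝕜 s ⊔ (varIdeal 𝕜 W₂ ⊔ I)) n)
    (h2 : RegLE (pairIdeal 𝕜 t ⊔ (varIdeal 𝕜 W₁ ⊔ I)) n) :
    RegLE (pairIdeal 𝕜 (s ∪ (t ∪ (W₁ ×ˢ W₂ ∪ W₂ ×ˢ W₁))) ⊔ I) n := by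
  refine hI.regLE_join_of_complete hd hs ht hrn h h1 ?_
  have hset : W₁ ×ˢ W₁ ∪ (t ∪ (W₁ ×ˢ W₂ ∪ W₂ ×ˢ W₁)) =
      t ∪ (W₁ ×ˢ W₁ ∪ (W₂ ×ˢ W₁ ∪ W₁ ×ˢ W₂)) := by
    rw [Set.union_left_comm, Set.union_comm (W₁ ×ˢ W₂)]
  rw [hset]
  rw [Set.union_comm] at hI
  refine hI.regLE_join_of_complete hd.symm ht subset_rfl hrn h h2 ?_
  have hset' : W₂ ×ˢ W₂ ∪ (W₁ ×ˢ W₁ ∪ (W₂ ×ˢ W₁ ∪ W₁ ×ˢ W₂)) = (W₂ ∪ W₁) ×ˢ (W₂ ∪ W₁) := by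
    rw [Set.union_prod, Set.prod_union, Set.prod_union]
    ac_rfl
  rw [hset']
  exact (hI.regLE_complete h).mono (by omega)

end PairIdeal

/-! ### Cographs -/

namespace SimpleGraph

variable {V : Type*}

/-- `G` has no induced path on four vertices, in terms of the adjacency relation. -/
def NoInducedPath (G : SimpleGraph V) : Prop :=
  ∀ a b c d, G.Adj a b → G.Adj b c → G.Adj c d → ¬G.Adj a c → ¬G.Adj b d → ¬G.Adj a d →
    a ≠ c → b ≠ d → a ≠ d → False

lemma IsCograph.noInducedPath {G : SimpleGraph V} (hG : G.IsCograph) : G.NoInducedPath := by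
  intro a b c d hab hbc hcd hac hbd had ac bd ad
  refine hG ⟨⟨⟨![a, b, c, d], ?_⟩, ?_⟩⟩
  · intro i j hij
    fin_cases i <;> fin_cases j <;> simp_all
  · intro i j
    change G.Adj (![a, b, c, d] i) (![a, b, c, d] j) ↔ _
    fin_cases i <;> fin_cases j <;>
      simp [pathGraph_adj, hab, hbc, hcd, hac, hbd, had, hab.symm, hbc.symm, hcd.symm,
        G.adj_comm c a, G.adj_comm d b, G.adj_comm d a]

/-- The path on four vertices is self-complementary. -/
lemma NoInducedPath.compl {G : SimpleGraph V} (hG : G.NoInducedPath) : Gᶜ.NoInducedPath := by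
  intro a b c d hab hbc hcd hac hbd had ac bd ad
  simp only [compl_adj, not_and, not_not] at *
  exact hG b d a c (hbd bd) (had ad).symm (hac ac) (fun h => hab.2 h.symm) (fun h => hcd.2 h.symm)
    hbc.2 hab.1.symm hcd.1.symm hbc.1

/-- `W` is the disjoint union of two nonempty sets without edges between them. -/
def Separated (G : SimpleGraph V) (W W₁ W₂ : Finset V) : Prop :=
  W₁.Nonempty ∧ W₂.Nonempty ∧ Disjoint W₁ W₂ ∧ (W₁ : Set V) ∪ W₂ = W ∧
    ∀ i ∈ W₁, ∀ j ∈ W₂, ¬G.Adj i j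

lemma Separated.symm {G : SimpleGraph V} {W W₁ W₂ : Finset V} (h : G.Separated W W₁ W₂) :
    G.Separated W W₂ W₁ :=
  ⟨h.2.1, h.1, h.2.2.1.symm, by rw [Set.union_comm]; exact h.2.2.2.1,
    fun i hi j hj hij => h.2.2.2.2 j hj i hi hij.symm⟩

/-- If `W` is separated in `G`, then so is `insert v W` in `G` or in the complement. -/
lemma NoInducedPath.separated_insert [DecidableEq V] {G : SimpleGraph V} (hG : G.NoInducedPath)
    {W W₁ W₂ : Finset V} (hW : G.Separated W W₁ W₂) {v : V} (hv : v ∉ W) :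
    (∃ A B, G.Separated (insert v W) A B) ∨ ∃ A B, Gᶜ.Separated (insert v W) A B := by
  classical
  by_cases hall : ∀ u ∈ W, G.Adj v u
  · refine Or.inr ⟨{v}, W, Finset.singleton_nonempty v, ?_, Finset.disjoint_singleton_left.mpr hv,
      by simp, fun i hi j hj => ?_⟩
    · obtain ⟨i, hi⟩ := hW.1
      have : i ∈ (W : Set V) := hW.2.2.2.1 ▸ Or.inl hi
      exact ⟨i, this⟩
    · rw [Finset.mem_singleton] at hi
      subst hi
      exact fun h => h.2 (hall j hj)
  left
  push Not at hall
  obtain ⟨u, huW, huv⟩ := hall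
  wlog hu : u ∈ W₁ generalizing W₁ W₂
  · have huW' : u ∈ (W₁ : Set V) ∪ W₂ := hW.2.2.2.1 ▸ huW
    exact this hW.symm (huW'.resolve_left hu)
  obtain ⟨-, ⟨w, hw⟩, hd, hU, hno⟩ := hW
  have hmem : ∀ i, i ∈ W ↔ i ∈ W₁ ∨ i ∈ W₂ := fun i => by
    rw [← Finset.mem_coe, ← hU]; rfl
  -- the connected component of `u` in the subgraph induced on `W`
  let r : V → V → Prop := fun i j => G.Adj i j ∧ j ∈ W
  let C : Finset V := W.filter (Relation.ReflTransGen r u)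
  have hC : ∀ i, i ∈ C ↔ i ∈ W ∧ Relation.ReflTransGen r u i := fun i => Finset.mem_filter
  have huC : u ∈ C := (hC u).mpr ⟨huW, Relation.ReflTransGen.refl⟩
  have hCW₁ : ∀ i, Relation.ReflTransGen r u i → i ∈ W₁ := fun i hi => by
    induction hi with
    | refl => exact hu
    | tail _ h ih =>
      exact ((hmem _).mp h.2).resolve_right fun h' => hno _ ih _ h' h.1
  by_cases hCv : ∃ a ∈ C, G.Adj v a
  · by_cases hBv : ∃ c ∈ W₂, G.Adj v c
    · exfalso
      obtain ⟨c, hc, hvc⟩ := hBv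
      obtain ⟨a, ha, hva⟩ := hCv
      -- the first vertex adjacent to `v` on a path from `u` to `a` gives an induced path
      have key : ∀ i, Relation.ReflTransGen r u i → ¬G.Adj v i := fun i hi => by
        induction hi with
        | refl => exact huv
        | @tail b a hb h ih =>
          intro hva
          have hb₁ := hCW₁ b hb
          have ha₁ := hCW₁ a (hb.tail h)
          refine hG b a v c h.1 hva.symm hvc (fun h => ih h.symm) (hno a ha₁ c hc)
            (hno b hb₁ c hc) ?_ ?_ ?_
          · rintro rfl; exact hv ((hmem _).mpr (Or.inl hb₁))
          · rintro rfl; exact Finset.disjoint_left.mp hd ha₁ hc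
          · rintro rfl; exact Finset.disjoint_left.mp hd hb₁ hc
      exact key a ((hC a).mp ha).2 hva
    · push Not at hBv
      refine ⟨insert v W₁, W₂, Finset.insert_nonempty _ _, ⟨w, hw⟩, ?_, ?_, ?_⟩
      · rw [Finset.disjoint_insert_left]
        exact ⟨fun h => hv ((hmem v).mpr (Or.inr h)), hd⟩
      · rw [Finset.coe_insert, Set.insert_union, hU, Finset.coe_insert]
      · intro i hi j hj
        obtain rfl | hi := Finset.mem_insert.mp hi
        · exact hBv j hj
        · exact hno i hi j hj
  · push Not at hCv
    refine ⟨C, insert v (W \ C), ⟨u, huC⟩, Finset.insert_nonempty _ _, ?_, ?_, ?_⟩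
    · rw [Finset.disjoint_insert_right]
      exact ⟨fun h => hv ((hC v).mp h).1, Finset.disjoint_sdiff⟩
    · rw [Finset.coe_insert, Set.union_insert, ← Finset.coe_union,
        Finset.union_sdiff_of_subset (Finset.filter_subset _ _), Finset.coe_insert]
    · intro i hi j hj hij
      obtain rfl | hj := Finset.mem_insert.mp hj
      · exact hCv i hi hij.symm
      · obtain ⟨hjW, hjC⟩ := Finset.mem_sdiff.mp hj
        exact hjC ((hC j).mpr ⟨hjW, ((hC i).mp hi).2.tail ⟨hij, hjW⟩⟩)

/-- A cograph with at least two vertices is disconnected or its complement is. -/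
lemma NoInducedPath.exists_separated {G : SimpleGraph V} (hG : G.NoInducedPath) (W : Finset V)
    (hW : 2 ≤ W.card) :
    (∃ A B, G.Separated W A B) ∨ ∃ A B, Gᶜ.Separated W A B := by
  classical
  induction W using Finset.induction_on with
  | empty => simp at hW
  | insert v W hv ih =>
    by_cases hW' : 2 ≤ W.card
    · obtain ⟨A, B, h⟩ | ⟨A, B, h⟩ := ih hW'
      · exact hG.separated_insert h hv
      · have := hG.compl.separated_insert h hv
        rw [compl_compl] at this
        exact this.symm
    · rw [Finset.card_insert_of_notMem hv] at hW
      obtain ⟨u, rfl⟩ := Finset.card_eq_one.mp (by omega : W.card = 1)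
      have hvu : v ≠ u := by simpa using hv
      by_cases h : G.Adj v u
      · exact Or.inr ⟨{v}, {u}, by simp, by simp, by simpa using hvu,
          by simp [Set.pair_comm], by simp [h]⟩
      · exact Or.inl ⟨{v}, {u}, by simp, by simp, by simpa using hvu,
          by simp [Set.pair_comm], by simp [h]⟩

end SimpleGraph

section Cographs

variable {𝕜 V : Type*} [Field 𝕜] [Fintype V] [LinearOrder V]

/-- The edges of the subgraph induced on `W`, as ordered pairs. -/
def SimpleGraph.inducedPairs (G : SimpleGraph V) (W : Set V) : Set (V × V) :=
  {p | p.1 ∈ W ∧ p.2 ∈ W ∧ G.Adj p.1 p.2}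

/-- `2n/3` bounds the regularity of the binomial edge ideal of the subgraph induced on a set of `n`
vertices, modulo any ideal in the other variables. -/
def CographBound (𝕜 : Type*) [Field 𝕜] (G : SimpleGraph V) (W : Finset V) : Prop :=
  ∀ (I : Ideal (MvPolynomial (BEIVar V) 𝕜)) (r : ℕ), FreeOf (vertexVars (W : Set V)) I →
    RegLE I r → RegLE (pairIdeal 𝕜 (G.inducedPairs W) ⊔ I) (r + 2 * W.card / 3)

/-- If the subgraph on `W` is a join of two subgraphs satisfying the bound, then each of them has at
most `|W| - 1` vertices, which improves the bound for `W`. -/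
lemma SimpleGraph.Separated.regLE_of_compl {G : SimpleGraph V} {W W₁ W₂ : Finset V}
    (h : Gᶜ.Separated W W₁ W₂) (h1 : CographBound 𝕜 G W₁) (h2 : CographBound 𝕜 G W₂)
    {I : Ideal (MvPolynomial (BEIVar V) 𝕜)} {r : ℕ} (hI : FreeOf (vertexVars (W : Set V)) I)
    (hr : RegLE I r) :
    RegLE (pairIdeal 𝕜 (G.inducedPairs W) ⊔ I) (r + max (2 * (W.card - 1) / 3) 2) := by
  obtain ⟨hn1, hn2, hd, hU, hadj⟩ := h
  have hcard : W₁.card + W₂.card = W.card := by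
    rw [← Finset.card_union_of_disjoint hd]
    congr 1
    rw [← Finset.coe_inj, Finset.coe_union, hU]
  have hc1 := hn1.card_pos
  have hc2 := hn2.card_pos
  have hd' : Disjoint (W₁ : Set V) W₂ := Finset.disjoint_coe.mpr hd
  have hadj' : ∀ i ∈ W₁, ∀ j ∈ W₂, G.Adj i j := fun i hi j hj => by
    by_contra hij
    refine hadj i hi j hj ((G.compl_adj i j).mpr ⟨?_, hij⟩)
    rintro rfl
    exact Finset.disjoint_left.mp hd hi hj
  have hset : G.inducedPairs W = G.inducedPairs W₁ ∪ (G.inducedPairs W₂ ∪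
      ((W₁ : Set V) ×ˢ (W₂ : Set V) ∪ (W₂ : Set V) ×ˢ (W₁ : Set V))) := by
    ext ⟨i, j⟩
    rw [← hU]
    have := hadj' i
    have := fun hj hi => (hadj' j hj i hi).symm
    simp only [SimpleGraph.inducedPairs, Set.mem_union, Set.mem_ofPred_eq, Set.mem_prod,
      Finset.mem_coe]
    tauto
  rw [hset]
  rw [← hU] at hI
  have hI₁ := hI.mono (vertexVars_mono Set.subset_union_left)
  have hI₂ := hI.mono (vertexVars_mono Set.subset_union_right)
  refine hI.regLE_join hd' (fun p hp => ⟨hp.1, hp.2.1⟩) (fun p hp => ⟨hp.1, hp.2.1⟩)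
    (by omega) hr ?_ ?_
  · exact (h1 _ _ ((freeOf_varIdeal hd'.symm).sup hI₁)
      (hI.regLE_varIdeal_sup Set.subset_union_right hr)).mono (by omega)
  · exact (h2 _ _ ((freeOf_varIdeal hd').sup hI₂)
      (hI.regLE_varIdeal_sup Set.subset_union_left hr)).mono (by omega)

/-- For a disjoint union the regularities add up, and `n ↦ ⌊2n/3⌋` is superadditive. -/
lemma SimpleGraph.Separated.cographBound {G : SimpleGraph V} {W W₁ W₂ : Finset V}
    (h : G.Separated W W₁ W₂) (h1 : CographBound 𝕜 G W₁) (h2 : CographBound 𝕜 G W₂) :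
    CographBound 𝕜 G W := by
  intro I r hI hr
  obtain ⟨-, -, hd, hU, hadj⟩ := h
  have hcard : W₁.card + W₂.card = W.card := by
    rw [← Finset.card_union_of_disjoint hd]
    congr 1
    rw [← Finset.coe_inj, Finset.coe_union, hU]
  have hset : G.inducedPairs W = G.inducedPairs W₁ ∪ G.inducedPairs W₂ := by
    ext ⟨i, j⟩
    rw [← hU]
    have := hadj i
    have := fun hj hi hij => hadj j hj i hi (G.adj_symm hij)
    simp only [SimpleGraph.inducedPairs, Set.mem_union, Set.mem_ofPred_eq, Finset.mem_coe]
    tauto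
  rw [← hU] at hI
  rw [hset, pairIdeal_union, sup_assoc]
  have hfree : FreeOf (vertexVars (W₁ : Set V)) (pairIdeal 𝕜 (G.inducedPairs (W₂ : Set V)) ⊔ I) := by
    refine (freeOf_pairIdeal fun i j hij => ?_).sup
      (hI.mono (vertexVars_mono Set.subset_union_left))
    exact ⟨fun hi => Finset.disjoint_left.mp hd hi hij.1,
      fun hj => Finset.disjoint_left.mp hd hj hij.2.1⟩
  exact (h1 _ _ hfree (h2 I r (hI.mono (vertexVars_mono Set.subset_union_right)) hr)).mono
    (by omega)

/-- Induction along the decomposition of a cograph into disjoint unions and joins. -/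
lemma SimpleGraph.NoInducedPath.cographBound {G : SimpleGraph V} (hG : G.NoInducedPath)
    (W : Finset V) : CographBound 𝕜 G W := by
  induction W using Finset.strongInduction with
  | H W ih =>
  have hssub : ∀ {H : SimpleGraph V} {A B : Finset V}, H.Separated W A B → A ⊂ W := by
    intro H A B h
    obtain ⟨-, ⟨b, hb⟩, hd, hU, -⟩ := h
    rw [← Finset.coe_ssubset, ← hU, Set.ssubset_iff_of_subset Set.subset_union_left]
    exact ⟨b, Or.inr hb, fun hbA => Finset.disjoint_left.mp hd hbA hb⟩
  by_cases hW : 3 ≤ W.card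
  · obtain ⟨A, B, h⟩ | ⟨A, B, h⟩ := hG.exists_separated W (by omega)
    · exact h.cographBound (ih A (hssub h)) (ih B (hssub h.symm))
    · intro I r hI hr
      exact (h.regLE_of_compl (ih A (hssub h)) (ih B (hssub h.symm)) hI hr).mono (by omega)
  · -- with at most two vertices the graph is complete or has no edges
    intro I r hI hr
    by_cases hedge : ∃ u v, (u, v) ∈ G.inducedPairs (W : Set V)
    · obtain ⟨u, v, hu, hv, huv⟩ := hedge
      have hsub : {u, v} ⊆ W := by
        intro i hi
        obtain rfl | rfl := Finset.mem_insert.mp hi |>.imp id Finset.mem_singleton.mp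
        exacts [hu, hv]
      have hcard : ({u, v} : Finset V).card = 2 := Finset.card_pair huv.ne
      obtain rfl := Finset.eq_of_subset_of_card_le hsub (by omega)
      have hK : pairIdeal 𝕜 (G.inducedPairs (({u, v} : Finset V) : Set V)) =
          pairIdeal 𝕜 ((({u, v} : Finset V) : Set V) ×ˢ (({u, v} : Finset V) : Set V)) := by
        refine le_antisymm (pairIdeal_mono fun p hp => ⟨hp.1, hp.2.1⟩)
          (pairIdeal_le_iff.mpr fun i j hij => ?_)
        by_cases hne : i = j
        · subst hne
          rw [pairMinor, mul_comm, sub_self]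
          exact Ideal.zero_mem _
        · refine pairMinor_mem ⟨hij.1, hij.2, ?_⟩
          have h1 := hij.1
          have h2 := hij.2
          simp only [Finset.coe_insert, Finset.coe_singleton, Set.mem_insert_iff,
            Set.mem_singleton_iff] at h1 h2
          obtain rfl | rfl := h1 <;> obtain rfl | rfl := h2
          exacts [absurd rfl hne, huv, huv.symm, absurd rfl hne]
      rw [hK]
      exact (hI.regLE_complete hr).mono (by omega)
    · have : pairIdeal 𝕜 (G.inducedPairs (W : Set V)) = ⊥ :=
        le_bot_iff.mp (pairIdeal_le_iff.mpr fun i j hij => absurd ⟨i, j, hij⟩ hedge)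
      rw [this, bot_sup_eq]
      exact hr.mono (Nat.le_add_right _ _)

end Cographs

theorem mainTheorem1 {𝕜 : Type*} [Field 𝕜] {V : Type*} [Fintype V] [LinearOrder V]
    (G : SimpleGraph V) (hG : G.IsCograph) (k a : ℕ) (ha : a ≤ 2)
    (hn : Fintype.card V + a = 3 * k) :
    regBEI 𝕜 G ≤ (((2 * k - a : ℤ) : WithTop ℤ) : WithBot (WithTop ℤ)) ∧
    regBEI 𝕜 G ≤
      (((⌊(2 * Fintype.card V / 3 : ℚ)⌋ : ℤ) : WithTop ℤ) : WithBot (WithTop ℤ)) ∧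
    (G.Connected → 1 < k → a ≤ 1 →
      regBEI 𝕜 G ≤ (((2 * k - a - 1 : ℤ) : WithTop ℤ) : WithBot (WithTop ℤ))) := by
  have hpairs : G.inducedPairs ((Finset.univ : Finset V) : Set V) = {p | G.Adj p.1 p.2} := by
    ext p; simp [SimpleGraph.inducedPairs]
  have hreg : ∀ (n : ℕ) (m : ℤ), (n : ℤ) ≤ m →
      RegLE (pairIdeal 𝕜 (G.inducedPairs ((Finset.univ : Finset V) : Set V)) ⊔ ⊥) n →
      regBEI 𝕜 G ≤ ((m : WithTop ℤ) : WithBot (WithTop ℤ)) := by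
    intro n m hnm h
    rw [sup_bot_eq, hpairs, ← binomialEdgeIdeal_eq_pairIdeal] at h
    exact h.cmRegularity_le.trans
      (WithBot.coe_le_coe.mpr (WithTop.coe_le_coe.mpr hnm))
  have hbound : ∀ W : Finset V, CographBound 𝕜 G W := hG.noInducedPath.cographBound
  have h0 := hbound Finset.univ ⊥ 0 (freeOf_bot _) (regLE_bot _ _)
  rw [Finset.card_univ] at h0
  refine ⟨hreg _ _ ?_ h0, hreg _ _ ?_ h0, fun hconn hk ha1 => ?_⟩
  · omega
  · rw [Int.le_floor]
    have : (3 * (2 * Fintype.card V / 3) : ℕ) ≤ 2 * Fintype.card V := Nat.mul_div_le _ _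
    have h' : (3 * ((2 * Fintype.card V / 3 : ℕ) : ℚ)) ≤ 2 * Fintype.card V := by exact_mod_cast this
    rw [le_div_iff₀ (by norm_num), zero_add, mul_comm]
    exact_mod_cast h'
  · have hcard : 2 ≤ (Finset.univ : Finset V).card := by rw [Finset.card_univ]; omega
    obtain ⟨A, B, h⟩ | ⟨A, B, h⟩ := hG.noInducedPath.exists_separated Finset.univ hcard
    · exfalso
      obtain ⟨⟨x, hx⟩, ⟨y, hy⟩, hd, hU, hno⟩ := h
      -- a walk from `x` cannot leave `A`
      have hA : ∀ z, Relation.ReflTransGen G.Adj x z → z ∈ A := fun z hz => by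
        induction hz with
        | refl => exact hx
        | @tail b c _ hbc ih =>
          have hc : c ∈ (A : Set V) ∪ B := by rw [hU]; simp
          exact hc.resolve_right fun hc => hno b ih c hc hbc
      have hxy := (G.reachable_iff_reflTransGen x y).mp (hconn.preconnected x y)
      exact Finset.disjoint_left.mp hd (hA y hxy) hy
    · refine hreg _ _ ?_
        (h.regLE_of_compl (hbound A) (hbound B) (freeOf_bot _) (regLE_bot _ _))
      rw [Finset.card_univ]
      omega
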